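/- Let $G=(V,E)$ be a finite simple $3$-regular graph on $n=|V|$ vertices with girth at least $7$, and consider $n$ qubits labelled by $V$. For $v\in V$ let $B(v)$ consist of $v$ and its three neighbours, let $Z_S$ (for $S\subseteq V$) act as the Pauli matrix $Z$ on the qubits in $S$ and as the identity on the others, let $X_v$ be the Pauli matrix $X$ acting on qubit $v$, and let $$H_3=\sum_{v\in V}\Big(\tfrac12 I-\tfrac14\sum_{u\sim v}Z_{\{v,u\}}+\tfrac14 Z_{B(v)}\Big),\qquad H_M=\sum_{v\in V}X_v .$$ (On a computational basis state, $H_3$ counts the vertices at least half of whose incident edges are cut.) With $|s\rangle=2^{-n/2}\sum_{z\in\{0,1\}^V}|z\rangle$ and $|\gamma,\beta\rangle=e^{-i\beta H_M}e^{-i\gamma H_3}|s\rangle$, let $F(\gamma,\beta)=\langle\gamma,\beta|H_3|\gamma,\beta\rangle$ be the one-round QAOA expectation. Then for all real $\gamma,\beta$, $$\begin{aligned}F(\gamma,\beta)=\;&\tfrac n2+\tfrac{3n}{2}\cos(2\beta)\sin(2\beta)\sin\gamma\cos\gamma\cos^4\tfrac\gamma2\\ &+\tfrac n{16}\sin(2\beta)\cos^3(2\beta)\cos^3\tfrac\gamma2\,\big(3\sin\tfrac{3\gamma}2-\sin\tfrac{5\gamma}2\big)\\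 &+\tfrac{3n}{16}\sin(2\beta)\cos^3(2\beta)\sin\tfrac\gamma2\cos^2\tfrac\gamma2\,\big(3\cos\tfrac{3\gamma}2+\cos\tfrac{5\gamma}2\big)\\ &-\tfrac{3n}4\sin^3(2\beta)\cos(2\beta)\sin\tfrac\gamma2\cos^5\gamma\cos^5\tfrac\gamma2\\ &-\tfrac n4\sin^3(2\beta)\cos(2\beta)\cos^6\tfrac\gamma2\Big(\tfrac1{64}\sin\tfrac\gamma2\,\big(3\cos\tfrac{3\gamma}2+\cos\tfrac{5\gamma}2\big)^3+\sin^3\gamma\cos^3\gamma\cos^4\tfrac\gamma2\Big).\end{aligned}$$ Moreover, there exist angles $\gamma^*\in[0,2\pi)$ and $\beta^*\in[0,\pi)$ with $0.819\,n\le F(\gamma^*,\beta^*)\le 0.8195\,n$; in particular $F(\gamma^*,\beta^*)\ge 0.81\,n$. -/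

import Mathlib

noncomputable section

namespace LocalMaxCutQAOA

/-- Operators on the Hilbert space of qubits labelled by `V`, written as matrices in the
computational basis; the basis vectors `|x⟩` are indexed by the strings `x : V → Fin 2`. -/
abbrev Op (V : Type*) : Type _ := Matrix (V → Fin 2) (V → Fin 2) ℂ

/-- The Pauli matrix `X`. -/
def pauliX : Matrix (Fin 2) (Fin 2) ℂ := !![0, 1; 1, 0]

/-- The Pauli matrix `Z`. -/
def pauliZ : Matrix (Fin 2) (Fin 2) ℂ := !![1, 0; 0, -1]

variable {V : Type*} [Fintype V] [DecidableEq V]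

/-- The tensor product `⨂ v, M v` of one-qubit operators. -/
def tensorOp (M : V → Matrix (Fin 2) (Fin 2) ℂ) : Op V :=
  Matrix.of fun x y => ∏ v, M v (x v) (y v)

/-- `M_K`: the one-qubit operator `M` on every qubit in `K`, the identity on the others. -/
def onQubits (M : Matrix (Fin 2) (Fin 2) ℂ) (K : Finset V) : Op V :=
  tensorOp fun v => if v ∈ K then M else 1

/-- `U(A, θ) = exp (-iθA)`. -/
def gate (A : Op V) (θ : ℝ) : Op V :=
  NormedSpace.exp ((-(Complex.I * (θ : ℂ))) • A)

/-- The mixing operator `H_M = ∑ v, X_v`. -/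
def mixer (V : Type*) [Fintype V] [DecidableEq V] : Op V :=
  ∑ v : V, onQubits pauliX {v}

/-- The uniform superposition `|s⟩ = 2^{-n/2} ∑ z, |z⟩`. -/
def uniformState (V : Type*) [Fintype V] : (V → Fin 2) → ℂ :=
  fun _ => (((Real.sqrt 2) ^ Fintype.card V : ℝ) : ℂ)⁻¹

/-- The one-round QAOA state `|γ, β⟩ = U(H_M, β) U(H, γ) |s⟩`. -/
def qaoaState (H : Op V) (γ β : ℝ) : (V → Fin 2) → ℂ :=
  (gate (mixer V) β).mulVec ((gate H γ).mulVec (uniformState V))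

/-- The QAOA expectation `F(γ, β) = ⟨γ, β| H |γ, β⟩`. -/
def qaoaExpectation (H : Op V) (γ β : ℝ) : ℂ :=
  star (qaoaState H γ β) ⬝ᵥ H.mulVec (qaoaState H γ β)

/-- The local term `½ I - ¼ ∑_{u ~ v} Z_{v,u} + ¼ Z_{B(v)}`, where `B(v)` consists of `v` and its
neighbours. -/
def localTerm (G : SimpleGraph V) [DecidableRel G.Adj] (v : V) : Op V :=
  (1 / 2 : ℂ) • (1 : Op V)
    - (1 / 4 : ℂ) • ∑ u ∈ G.neighborFinset v, onQubits pauliZ {v, u}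
    + (1 / 4 : ℂ) • onQubits pauliZ (insert v (G.neighborFinset v))

/-- The `LocalMaxCut` Hamiltonian `H_3` of a 3-regular graph. -/
def hamiltonian (G : SimpleGraph V) [DecidableRel G.Adj] : Op V :=
  ∑ v : V, localTerm G v

end LocalMaxCutQAOA

end

/-!
In the Heisenberg picture the mixer rotates every `Z_v` into `cos(2β) Z_v + sin(2β) Y_v`, so the
expectation of a string `Z_S` is a sum over `B ⊆ S` of correlators of `Z_{S∖B} Y_B`
(`expectation_pauliZ`). The Hamiltonian is diagonal, and `Y_B` flips the bits in `B`; hence each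
correlator is an average, over all bit strings `z`, of the sign `χ_S(z)` times the phase
`exp (iγ (H(z with B flipped) - H(z)))`. That phase is a product over the edges and the stars
whose sign changes under the flip (`exp_energy_diff`), all of which lie within distance three of
the vertex `v` that is considered.

As the girth is at least seven, the vertices within distance three of `v`, with all edges except
those joining two vertices at distance three, form a tree. It is bipartite, and flipping one
colour class shows that correlators with an even number of `Y`s vanish (`corr_eq_zero_of_even`).
In the others, a star or edge operator containing a vertex that no other factor sees is an
independent uniform sign, which may be averaged separately (`sum_prod_pivot`,
`avg_prod_chi_pivot`). Working inwards from the leaves leaves an average over at most three edge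
signs at one vertex (`avg_three_edges`), that is, an explicit trigonometric polynomial. The five
types of odd correlators are `corr_edge`, `corr_star_center`, `corr_star_leaf`,
`corr_star_center_and_two` and `corr_star_leaves`.

The angles for the numerical bounds come from Pythagorean triples, so that the formula takes a
rational value there.
-/

noncomputable section

namespace LocalMaxCutQAOA

/-! ### Operators in the computational basis -/

section Operators

variable {V : Type*} [Fintype V]

/-- The eigenvalue `±1` of the Pauli matrix `Z` on the basis vector `|a⟩`. -/
def spin (a : Fin 2) : ℝ := if a = 0 then 1 else -1

@[simp] theorem spin_zero : spin 0 = 1 := rfl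

@[simp] theorem spin_one : spin 1 = -1 := by simp [spin]

theorem spin_add (a b : Fin 2) : spin (a + b) = spin a * spin b := by
  fin_cases a <;> fin_cases b <;> simp [spin]

theorem spin_eq (a : Fin 2) : spin a = 1 ∨ spin a = -1 := by
  fin_cases a <;> simp [spin]

@[simp] theorem spin_mul_self (a : Fin 2) : spin a * spin a = 1 := by
  fin_cases a <;> simp [spin]

theorem tensorOp_diagonal (d : V → Fin 2 → ℂ) :
    tensorOp (fun v => Matrix.diagonal (d v)) = Matrix.diagonal fun z => ∏ v, d v (z v) := by
  ext x y
  by_cases h : x = y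
  · subst h; simp [tensorOp]
  · obtain ⟨v, hv⟩ := Function.ne_iff.mp h
    rw [Matrix.diagonal_apply_ne _ h]
    exact Finset.prod_eq_zero (Finset.mem_univ v) (Matrix.diagonal_apply_ne _ hv)

theorem tensorOp_conjTranspose (M : V → Matrix (Fin 2) (Fin 2) ℂ) :
    (tensorOp M).conjTranspose = tensorOp fun v => (M v).conjTranspose := by
  ext x y
  simp [tensorOp, Matrix.conjTranspose_apply]

theorem tensorOp_one : tensorOp (fun _ : V => (1 : Matrix (Fin 2) (Fin 2) ℂ)) = 1 := by
  have := tensorOp_diagonal (V := V) (fun _ _ => 1)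
  simpa using this

variable [DecidableEq V]

/-- The eigenvalue of `Z_T` on `|z⟩`: the product of the spins of `z` over `T`. -/
def chi (T : Finset V) (z : V → Fin 2) : ℝ := ∏ v ∈ T, spin (z v)

/-- The bit string with ones exactly on `B`. Since bits add modulo two, `z + ind B` is `z` with
the bits in `B` flipped. -/
def ind (B : Finset V) : V → Fin 2 := fun v => if v ∈ B then 1 else 0

/-- The eigenvalue of the Hamiltonian on `|z⟩`; the Hamiltonian is diagonal. -/
def energy (G : SimpleGraph V) [DecidableRel G.Adj] (z : V → Fin 2) : ℝ :=
  ∑ v, (1 / 2 - 1 / 4 * ∑ u ∈ G.neighborFinset v, chi {v, u} z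
    + 1 / 4 * chi (insert v (G.neighborFinset v)) z)

theorem tensorOp_mul (M N : V → Matrix (Fin 2) (Fin 2) ℂ) :
    tensorOp M * tensorOp N = tensorOp fun v => M v * N v := by
  ext x y
  simp only [tensorOp, Matrix.mul_apply, Matrix.of_apply]
  rw [Finset.prod_univ_sum, Fintype.piFinset_univ]
  simp only [Finset.prod_mul_distrib]

theorem pauliZ_eq_diagonal : pauliZ = Matrix.diagonal fun a => (spin a : ℂ) := by
  ext i j; fin_cases i <;> fin_cases j <;> simp [pauliZ, Matrix.diagonal]

theorem onQubits_pauliZ (S : Finset V) :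
    onQubits pauliZ S = Matrix.diagonal fun z => (chi S z : ℂ) := by
  have h : (fun v => if v ∈ S then pauliZ else 1) =
      fun v => Matrix.diagonal fun a => if v ∈ S then (spin a : ℂ) else 1 := by
    funext v
    split_ifs
    · exact pauliZ_eq_diagonal
    · simp
  rw [onQubits, h, tensorOp_diagonal]
  congr 1
  funext z
  simp [chi, Finset.prod_ite_mem]

theorem hamiltonian_eq_diagonal (G : SimpleGraph V) [DecidableRel G.Adj] :
    hamiltonian G = Matrix.diagonal fun z => (energy G z : ℂ) := by
  ext x y
  by_cases h : x = y
  · subst h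
    simp [hamiltonian, localTerm, energy, onQubits_pauliZ, Matrix.sum_apply]
  · simp [hamiltonian, localTerm, onQubits_pauliZ, Matrix.sum_apply, h]

theorem gate_diagonal (d : (V → Fin 2) → ℝ) (θ : ℝ) :
    gate (Matrix.diagonal fun z => (d z : ℂ)) θ =
      Matrix.diagonal fun z => Complex.exp (-(Complex.I * (θ * d z : ℝ))) := by
  rw [gate, ← Matrix.diagonal_smul, Matrix.exp_diagonal]
  congr 1
  funext z
  rw [Pi.coe_exp, ← Complex.exp_eq_exp_ℂ]
  simp [mul_assoc]

/-- The Hadamard matrix without its factor `1/√2`, so that its inverse is half of itself. -/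
def hadamard : Matrix (Fin 2) (Fin 2) ℂ := !![1, 1; 1, -1]

/-- The one-qubit rotation `exp (-iβX)`. -/
def rotX (β : ℝ) : Matrix (Fin 2) (Fin 2) ℂ :=
  !![Complex.cos β, -(Complex.I * Complex.sin β); -(Complex.I * Complex.sin β), Complex.cos β]

theorem hadamard_mul_half : hadamard * ((1 / 2 : ℂ) • hadamard) = 1 := by
  ext i j; fin_cases i <;> fin_cases j <;> simp [hadamard, Matrix.mul_apply] <;> norm_num

theorem half_mul_hadamard : ((1 / 2 : ℂ) • hadamard) * hadamard = 1 := by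
  ext i j; fin_cases i <;> fin_cases j <;> simp [hadamard, Matrix.mul_apply] <;> norm_num

theorem hadamard_conj_pauliZ : hadamard * pauliZ * ((1 / 2 : ℂ) • hadamard) = pauliX := by
  ext i j
  fin_cases i <;> fin_cases j <;>
    simp [hadamard, pauliX, pauliZ, Matrix.mul_apply] <;> norm_num

theorem hadamard_conj_exp (β : ℝ) :
    hadamard * (Matrix.diagonal fun a => Complex.exp (-(Complex.I * (β * spin a : ℝ)))) *
      ((1 / 2 : ℂ) • hadamard) = rotX β := by
  have e1 : Complex.exp (-(Complex.I * β)) = Complex.cos β - Complex.I * Complex.sin β := by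
    rw [show -(Complex.I * (β : ℂ)) = (-β : ℂ) * Complex.I by ring, Complex.exp_mul_I]
    simp; ring
  have e2 : Complex.exp (Complex.I * β) = Complex.cos β + Complex.I * Complex.sin β := by
    rw [mul_comm, Complex.exp_mul_I]; ring
  have hd : (Matrix.diagonal fun a => Complex.exp (-(Complex.I * (β * spin a : ℝ)))) =
      !![Complex.exp (-(Complex.I * β)), 0; 0, Complex.exp (Complex.I * β)] := by
    ext i j; fin_cases i <;> fin_cases j <;> simp
  rw [hd, e1, e2]
  ext i j
  fin_cases i <;> fin_cases j <;> simp [hadamard, rotX, Matrix.mul_apply] <;> ring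

theorem onQubits_pauliX_singleton (v : V) :
    onQubits pauliX {v} = tensorOp (fun _ : V => hadamard) * onQubits pauliZ {v} *
      tensorOp (fun _ : V => (1 / 2 : ℂ) • hadamard) := by
  rw [onQubits, onQubits, tensorOp_mul, tensorOp_mul]
  congr 1
  funext w
  split_ifs
  · exact hadamard_conj_pauliZ.symm
  · rw [mul_one, hadamard_mul_half]

/-- The mixing unitary is a tensor power of one-qubit rotations. Hadamard matrices on all qubits
turn the mixer into `∑ v, Z_v`, whose exponential is an entrywise exponential of a diagonal
matrix. -/
theorem gate_mixer (β : ℝ) : gate (mixer V) β = tensorOp fun _ => rotX β := by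
  set U : Op V := tensorOp fun _ : V => hadamard with hU
  set W : Op V := tensorOp fun _ : V => (1 / 2 : ℂ) • hadamard with hW
  have hUW : U * W = 1 := by
    rw [hU, hW, tensorOp_mul]; simp only [hadamard_mul_half]; exact tensorOp_one
  have hWU : W * U = 1 := by
    rw [hU, hW, tensorOp_mul]; simp only [half_mul_hadamard]; exact tensorOp_one
  have hmix : mixer V = U * (Matrix.diagonal fun z => ((∑ v, spin (z v) : ℝ) : ℂ)) * W := by
    have : (Matrix.diagonal fun z : V → Fin 2 => ((∑ v, spin (z v) : ℝ) : ℂ)) =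
        ∑ v : V, onQubits pauliZ {v} := by
      ext x y
      by_cases h : x = y
      · subst h; simp [onQubits_pauliZ, Matrix.sum_apply, chi]
      · simp [onQubits_pauliZ, Matrix.sum_apply, h]
    rw [this, mixer, Finset.mul_sum, Finset.sum_mul]
    exact Finset.sum_congr rfl fun v _ => onQubits_pauliX_singleton v
  have hinv : W = U⁻¹ := (Matrix.inv_eq_right_inv hUW).symm
  have hunit : IsUnit U := IsUnit.of_mul_eq_one W hUW 
  have hg : gate (mixer V) β =
      U * gate (Matrix.diagonal fun z => ((∑ v, spin (z v) : ℝ) : ℂ)) β * W := by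
    rw [gate, gate, hmix, hinv, ← Matrix.exp_conj U _ hunit]
    congr 1
    rw [Matrix.mul_smul, Matrix.smul_mul]
  have hd : gate (Matrix.diagonal fun z : V → Fin 2 => ((∑ v, spin (z v) : ℝ) : ℂ)) β =
      tensorOp fun _ => Matrix.diagonal fun a => Complex.exp (-(Complex.I * (β * spin a : ℝ))) := by
    rw [gate_diagonal, tensorOp_diagonal]
    congr 1
    funext z
    rw [← Complex.exp_sum]
    congr 1
    push_cast
    rw [Finset.mul_sum, Finset.mul_sum, Finset.sum_neg_distrib]
  rw [hg, hd, hU, hW, tensorOp_mul, tensorOp_mul]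
  simp only [hadamard_conj_exp]

/-- The diagonal of `e^{iβX} Z e^{-iβX} = cos(2β) Z + sin(2β) Y`. -/
theorem rotX_conj_pauliZ_diag (β : ℝ) (a : Fin 2) :
    ((rotX β).conjTranspose * pauliZ * rotX β) a a = (Real.cos (2 * β) : ℂ) * spin a := by
  have : (Real.cos (2 * β) : ℂ) =
      Complex.cos β * Complex.cos β - Complex.sin β * Complex.sin β := by
    push_cast; rw [two_mul, Complex.cos_add]
  rw [this]
  have hI := Complex.I_mul_I
  fin_cases a <;>
    simp [rotX, pauliZ, Matrix.mul_apply, Matrix.conjTranspose_apply, ← Complex.cos_conj,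
      ← Complex.sin_conj]
  · linear_combination Complex.sin β ^ 2 * hI
  · linear_combination -Complex.sin β ^ 2 * hI

/-- The off-diagonal part of `e^{iβX} Z e^{-iβX} = cos(2β) Z + sin(2β) Y`. -/
theorem rotX_conj_pauliZ_offDiag (β : ℝ) (a : Fin 2) :
    ((rotX β).conjTranspose * pauliZ * rotX β) (a + 1) a =
      Complex.I * (Real.sin (2 * β) : ℂ) * spin a := by
  have : (Real.sin (2 * β) : ℂ) = 2 * Complex.sin β * Complex.cos β := by
    push_cast; rw [Complex.sin_two_mul]
  rw [this]
  fin_cases a <;>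
    simp [rotX, pauliZ, Matrix.mul_apply, Matrix.conjTranspose_apply, ← Complex.cos_conj,
      ← Complex.sin_conj] <;> ring

theorem rotX_conjTranspose_mul_self (β : ℝ) : (rotX β).conjTranspose * rotX β = 1 := by
  have := Complex.cos_sq_add_sin_sq (β : ℂ)
  have hI := Complex.I_mul_I
  ext i j
  fin_cases i <;> fin_cases j <;>
    simp [rotX, Matrix.mul_apply, Matrix.conjTranspose_apply, ← Complex.cos_conj,
      ← Complex.sin_conj]
  · linear_combination this - Complex.sin β ^ 2 * hI
  · ring
  · ring
  · linear_combination this - Complex.sin β ^ 2 * hI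

/-! ### Expectations as sums of correlators -/

theorem fin_two_add_self (a : Fin 2) : a + a = 0 := by fin_cases a <;> rfl

omit [Fintype V] in
theorem ind_add_self (B : Finset V) : ind B + ind B = 0 := funext fun _ => fin_two_add_self _

omit [Fintype V] in
theorem add_ind_add_ind (z : V → Fin 2) (B : Finset V) : z + ind B + ind B = z := by
  rw [add_assoc, ind_add_self, add_zero]

/-- Bit strings are the indicators of sets of qubits. -/
def indEquiv : Finset V ≃ (V → Fin 2) where
  toFun := ind
  invFun d := Finset.univ.filter fun v => d v = 1
  left_inv B := by ext v; simp [ind]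
  right_inv d := by
    funext v
    have h : d v = 0 ∨ d v = 1 := by omega
    rcases h with h | h <;> simp [ind, h]

/-- The average over all bit strings. -/
def avg (F : (V → Fin 2) → ℂ) : ℂ := (2 ^ Fintype.card V : ℂ)⁻¹ * ∑ z, F z

/-- The correlator `2^{-n} ∑ z, χ_S(z) exp (iγ (H(z with B flipped) - H(z)))`. Up to the factor
`i ^ |B|` it is the expectation of `Z_{S∖B} Y_B`, for `B ⊆ S`, in the state reached from `|s⟩` by
the phase gate of `H`. -/
def corr (H : (V → Fin 2) → ℝ) (γ : ℝ) (S B : Finset V) : ℂ :=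
  avg fun z => (chi S z : ℂ) * Complex.exp (Complex.I * (γ * (H (z + ind B) - H z) : ℝ))

/-- The entries of `U(H_M, β)† Z_S U(H_M, β) = ∏_{v ∈ S} (cos(2β) Z_v + sin(2β) Y_v)`: choosing
`Y` exactly on `B` is the only way to get from `y` to `y` with `B` flipped. -/
theorem rotated_pauliZ_apply (β : ℝ) (S B : Finset V) (y : V → Fin 2) :
    tensorOp (fun v => (rotX β).conjTranspose * (if v ∈ S then pauliZ else 1) * rotX β)
        (y + ind B) y =
      if B ⊆ S then (Real.cos (2 * β) : ℂ) ^ (S \ B).card *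
        (Complex.I * (Real.sin (2 * β) : ℂ)) ^ B.card * chi S y else 0 := by
  have key : ∀ v, ((rotX β).conjTranspose * (if v ∈ S then pauliZ else 1) * rotX β)
      ((y + ind B) v) (y v) = if v ∈ S then
        ((if v ∈ B then Complex.I * (Real.sin (2 * β) : ℂ) else (Real.cos (2 * β) : ℂ)) *
          (spin (y v) : ℂ)) else if v ∈ B then 0 else 1 := by
    intro v
    by_cases hS : v ∈ S <;> by_cases hB : v ∈ B
    · simp only [hS, hB, if_true, Pi.add_apply, ind, rotX_conj_pauliZ_offDiag]
    · simp only [hS, hB, if_true, if_false, Pi.add_apply, ind, add_zero, rotX_conj_pauliZ_diag]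
    · simp only [hS, hB, if_true, if_false, Pi.add_apply, ind, mul_one,
        rotX_conjTranspose_mul_self]
      exact Matrix.one_apply_ne (by simp)
    · simp only [hS, hB, if_false, Pi.add_apply, ind, mul_one, rotX_conjTranspose_mul_self,
        add_zero, Matrix.one_apply_eq]
  simp only [tensorOp, Matrix.of_apply, key]
  split_ifs with hBS
  · have : ∀ v, (if v ∈ S then
        ((if v ∈ B then Complex.I * (Real.sin (2 * β) : ℂ) else (Real.cos (2 * β) : ℂ)) *
          (spin (y v) : ℂ)) else if v ∈ B then 0 else 1) = if v ∈ S then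
        ((if v ∈ B then Complex.I * (Real.sin (2 * β) : ℂ) else (Real.cos (2 * β) : ℂ)) *
          (spin (y v) : ℂ)) else 1 := by
      intro v
      by_cases hS : v ∈ S
      · simp [hS]
      · simp [hS, show v ∉ B from fun h => hS (hBS h)]
    rw [Finset.prod_congr rfl fun v _ => this v, Finset.prod_ite_mem, Finset.univ_inter,
      Finset.prod_mul_distrib, Finset.prod_ite, Finset.prod_const, Finset.prod_const,
      Finset.filter_mem_eq_inter, Finset.inter_eq_right.mpr hBS, ← Finset.sdiff_eq_filter, chi]
    push_cast
    ring
  · obtain ⟨v, hv, hvS⟩ := Finset.not_subset.mp hBS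
    exact Finset.prod_eq_zero (Finset.mem_univ v) (by simp [hv, hvS])

/-- The QAOA expectation of `Z_S`, for any diagonal cost Hamiltonian, as a sum of correlators over
the set `B ⊆ S` of qubits on which `Y` is chosen. -/
theorem expectation_pauliZ (h : (V → Fin 2) → ℝ) (γ β : ℝ) (S : Finset V) :
    star (qaoaState (Matrix.diagonal fun z => (h z : ℂ)) γ β) ⬝ᵥ
        (onQubits pauliZ S).mulVec (qaoaState (Matrix.diagonal fun z => (h z : ℂ)) γ β) =
      ∑ B ∈ S.powerset, (Real.cos (2 * β) : ℂ) ^ (S \ B).card *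
        (Complex.I * (Real.sin (2 * β) : ℂ)) ^ B.card * corr h γ S B := by
  set r : ℂ := (((Real.sqrt 2) ^ Fintype.card V : ℝ) : ℂ)⁻¹ with hr
  set φ : (V → Fin 2) → ℂ := fun z => Complex.exp (-(Complex.I * (γ * h z : ℝ))) * r with hφ
  have hstate : qaoaState (Matrix.diagonal fun z => (h z : ℂ)) γ β =
      (tensorOp fun _ => rotX β).mulVec φ := by
    rw [qaoaState, gate_mixer, gate_diagonal]
    congr 1
    funext z
    rw [Matrix.mulVec_diagonal]
    rfl
  have hrr : star r * r = (2 ^ Fintype.card V : ℂ)⁻¹ := by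
    have h2 : (Real.sqrt 2 : ℝ) * Real.sqrt 2 = 2 := Real.mul_self_sqrt (by norm_num)
    rw [hr, star_inv₀, Complex.star_def, Complex.conj_ofReal, ← mul_inv, ← Complex.ofReal_mul,
      ← mul_pow, h2]
    norm_num
  have hphase : ∀ x y, star (φ x) * φ y = (2 ^ Fintype.card V : ℂ)⁻¹ *
      Complex.exp (Complex.I * (γ * (h x - h y) : ℝ)) := by
    intro x y
    rw [← hrr]
    simp only [hφ, star_mul', Complex.star_def, ← Complex.exp_conj]
    rw [mul_mul_mul_comm, ← Complex.exp_add, mul_comm]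
    congr 2
    simp
    ring
  rw [hstate, Matrix.star_mulVec, ← Matrix.dotProduct_mulVec, Matrix.mulVec_mulVec,
    Matrix.mulVec_mulVec, tensorOp_conjTranspose, onQubits, tensorOp_mul, tensorOp_mul]
  set N := tensorOp (fun v => (rotX β).conjTranspose * (if v ∈ S then pauliZ else 1) * rotX β)
    with hN
  -- the row index is written as `y + ind B`
  have hexp : star φ ⬝ᵥ N.mulVec φ =
      ∑ y, ∑ B : Finset V, star (φ (y + ind B)) * (N (y + ind B) y * φ y) := by
    simp only [dotProduct, Matrix.mulVec, Finset.mul_sum]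
    rw [Finset.sum_comm]
    refine Finset.sum_congr rfl fun y _ => ?_
    rw [← (indEquiv.trans (Equiv.addLeft y)).sum_comp]
    rfl
  rw [hexp, Finset.sum_comm]
  have hterm : ∀ B : Finset V, ∑ y, star (φ (y + ind B)) * (N (y + ind B) y * φ y) =
      if B ⊆ S then (Real.cos (2 * β) : ℂ) ^ (S \ B).card *
        (Complex.I * (Real.sin (2 * β) : ℂ)) ^ B.card * corr h γ S B else 0 := by
    intro B
    simp only [hN, rotated_pauliZ_apply]
    split_ifs with hB
    · rw [corr, avg, Finset.mul_sum, Finset.mul_sum]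
      refine Finset.sum_congr rfl fun y _ => ?_
      rw [mul_left_comm, hphase]
      ring
    · simp
  rw [Finset.sum_congr rfl fun B _ => hterm B, ← Finset.sum_filter]
  refine Finset.sum_congr ?_ fun _ _ => rfl
  ext B
  simp

/-- The QAOA state is a unit vector: the case `S = ∅` of `expectation_pauliZ`. -/
theorem star_dotProduct_self (h : (V → Fin 2) → ℝ) (γ β : ℝ) :
    star (qaoaState (Matrix.diagonal fun z => (h z : ℂ)) γ β) ⬝ᵥ
        (qaoaState (Matrix.diagonal fun z => (h z : ℂ)) γ β) = 1 := by
  have := expectation_pauliZ h γ β ∅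
  rw [onQubits_pauliZ] at this
  simp only [chi, Finset.prod_empty, Complex.ofReal_one, Matrix.diagonal_one,
    Matrix.one_mulVec] at this
  rw [this]
  have h0 : (ind ∅ : V → Fin 2) = 0 := by funext v; simp [ind]
  simp [corr, avg, chi, h0, Finset.card_univ]

/-- The expectation of the Hamiltonian as a sum of correlators of edges and stars. -/
theorem qaoaExpectation_hamiltonian (G : SimpleGraph V) [DecidableRel G.Adj] (γ β : ℝ) :
    qaoaExpectation (hamiltonian G) γ β =
      ∑ v, (1 / 2 - 1 / 4 * (∑ u ∈ G.neighborFinset v,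
          ∑ B ∈ ({v, u} : Finset V).powerset,
            (Real.cos (2 * β) : ℂ) ^ (({v, u} : Finset V) \ B).card *
            (Complex.I * (Real.sin (2 * β) : ℂ)) ^ B.card * corr (energy G) γ {v, u} B)
        + 1 / 4 * ∑ B ∈ (insert v (G.neighborFinset v)).powerset,
            (Real.cos (2 * β) : ℂ) ^ (insert v (G.neighborFinset v) \ B).card *
            (Complex.I * (Real.sin (2 * β) : ℂ)) ^ B.card *
              corr (energy G) γ (insert v (G.neighborFinset v)) B) := by
  rw [qaoaExpectation]
  simp only [← expectation_pauliZ]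
  rw [hamiltonian_eq_diagonal]
  have h1 := star_dotProduct_self (energy G) γ β
  set ψ := qaoaState (Matrix.diagonal fun z => (energy G z : ℂ)) γ β
  rw [← hamiltonian_eq_diagonal, hamiltonian, Matrix.sum_mulVec, dotProduct_sum]
  refine Finset.sum_congr rfl fun v _ => ?_
  rw [localTerm, Matrix.add_mulVec, Matrix.sub_mulVec, Matrix.smul_mulVec, Matrix.smul_mulVec,
    Matrix.smul_mulVec, Matrix.one_mulVec, Matrix.sum_mulVec, dotProduct_add, dotProduct_sub,
    dotProduct_smul, dotProduct_smul, dotProduct_smul, dotProduct_sum, h1]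
  simp

end Operators

/-! ### Short closed walks -/

section Cycles

variable {V : Type*} {G : SimpleGraph V}

/-- Joining the ends of a path with two to five edges would close a cycle shorter than the
girth. -/
theorem not_isPath_of_adj (hg : 7 ≤ G.egirth) {a b : V} {p : G.Walk a b} (hp : p.IsPath)
    (h2 : 2 ≤ p.length) (h5 : p.length ≤ 5) (h : G.Adj b a) : False := by
  have hc : (SimpleGraph.Walk.cons h p).IsCycle := by
    rw [SimpleGraph.Walk.cons_isCycle_iff]
    refine ⟨hp, fun he => ?_⟩
    have := hp.length_eq_one_of_mem_edges (by rwa [Sym2.eq_swap])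
    omega
  have := SimpleGraph.le_egirth.mp hg _ _ hc
  rw [SimpleGraph.Walk.length_cons] at this
  have h7 : 7 ≤ p.length + 1 := by exact_mod_cast this
  omega

theorem no_closed_three (hg : 7 ≤ G.egirth) {a b c : V} (ab : G.Adj a b) (bc : G.Adj b c)
    (ca : G.Adj c a) : False :=
  not_isPath_of_adj hg (p := .cons ab (.cons bc .nil))
    (by simp [ab.ne, bc.ne, ca.ne']) (by simp) (by simp) ca

theorem no_closed_four (hg : 7 ≤ G.egirth) {a b c d : V} (ab : G.Adj a b) (bc : G.Adj b c)
    (cd : G.Adj c d) (da : G.Adj d a) (hac : a ≠ c) (hbd : b ≠ d) : False :=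
  not_isPath_of_adj hg (p := .cons ab (.cons bc (.cons cd .nil)))
    (by simp [ab.ne, bc.ne, cd.ne, da.ne', hac, hbd]) (by simp) (by simp) da

/-- No distinctness is assumed: a degenerate closed walk of odd length contains a shorter odd
one. -/
theorem no_closed_five (hg : 7 ≤ G.egirth) {a b c d e : V} (ab : G.Adj a b) (bc : G.Adj b c)
    (cd : G.Adj c d) (de : G.Adj d e) (ea : G.Adj e a) : False := by
  have hac : a ≠ c := by rintro rfl; exact no_closed_three hg cd de ea
  have hbd : b ≠ d := by rintro rfl; exact no_closed_three hg de ea ab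
  have hce : c ≠ e := by rintro rfl; exact no_closed_three hg ea ab bc
  have had : a ≠ d := by rintro rfl; exact no_closed_three hg ab bc cd
  have hbe : b ≠ e := by rintro rfl; exact no_closed_three hg bc cd de
  exact not_isPath_of_adj hg (p := .cons ab (.cons bc (.cons cd (.cons de .nil))))
    (by simp [ab.ne, bc.ne, cd.ne, de.ne, ea.ne', hac, hbd, hce, had, hbe]) (by simp) (by simp) ea

/-- It is enough that the walk does not backtrack; opposite vertices then differ, as there are no
triangles. -/
theorem no_closed_six (hg : 7 ≤ G.egirth) {a b c d e f : V} (ab : G.Adj a b) (bc : G.Adj b c)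
    (cd : G.Adj c d) (de : G.Adj d e) (ef : G.Adj e f) (fa : G.Adj f a)
    (hac : a ≠ c) (hbd : b ≠ d) (hce : c ≠ e) (hdf : d ≠ f) (hea : e ≠ a) (hfb : f ≠ b) :
    False := by
  have had : a ≠ d := by rintro rfl; exact no_closed_three hg ab bc cd
  have hbe : b ≠ e := by rintro rfl; exact no_closed_three hg bc cd de
  have hcf : c ≠ f := by rintro rfl; exact no_closed_three hg cd de ef
  exact not_isPath_of_adj hg (p := .cons ab (.cons bc (.cons cd (.cons de (.cons ef .nil)))))
    (by simp [ab.ne, bc.ne, cd.ne, de.ne, ef.ne, fa.ne', hac, hbd, hce, had, hbe, hcf, hdf,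
      hea.symm, hfb.symm]) (by simp) (by simp) fa

end Cycles

section Flips

variable {V : Type*} [DecidableEq V]

/-! ### Energy change under a flip -/

theorem chi_add_ind (T B : Finset V) (z : V → Fin 2) :
    chi T (z + ind B) = (-1) ^ (T ∩ B).card * chi T z := by
  have h : ∀ v, spin (ind B v) = if v ∈ B then -1 else 1 := fun v => by
    by_cases hv : v ∈ B <;> simp [ind, hv]
  simp only [chi, Pi.add_apply, spin_add, h, Finset.prod_mul_distrib]
  rw [Finset.prod_ite_mem, Finset.prod_const, mul_comm]

theorem chi_add_ind_singleton_of_notMem {T : Finset V} {v : V} (h : v ∉ T) (z : V → Fin 2) :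
    chi T (z + ind {v}) = chi T z := by
  rw [chi_add_ind, Finset.inter_singleton_of_notMem h]; simp

theorem chi_add_ind_singleton_of_mem {T : Finset V} {v : V} (h : v ∈ T) (z : V → Fin 2) :
    chi T (z + ind {v}) = - chi T z := by
  rw [chi_add_ind, Finset.inter_singleton_of_mem h]; simp

theorem chi_eq (T : Finset V) (z : V → Fin 2) : chi T z = 1 ∨ chi T z = -1 := by
  induction T using Finset.induction_on with
  | empty => simp [chi]
  | insert v T hv ih =>
    have : chi (insert v T) z = spin (z v) * chi T z := Finset.prod_insert hv
    rw [this]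
    rcases ih with h | h <;> rcases spin_eq (z v) with h' | h' <;> simp [h, h']

theorem chi_pair {u v : V} (h : u ≠ v) (z : V → Fin 2) :
    chi {u, v} z = spin (z u) * spin (z v) := Finset.prod_pair h

variable [Fintype V]

/-- The closed neighbourhood `B(v)`: the vertex `v` together with its neighbours. -/
abbrev closedNbhd (G : SimpleGraph V) [DecidableRel G.Adj] (v : V) : Finset V :=
  insert v (G.neighborFinset v)

/-- The vertices whose star operator `Z_{B(w)}` changes sign when the bits in `B` are flipped. -/
def oddCenters (G : SimpleGraph V) [DecidableRel G.Adj] (B : Finset V) : Finset V :=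
  Finset.univ.filter fun w => Odd (closedNbhd G w ∩ B).card

/-- The energy change of a flip: only the edges leaving `B` and the stars meeting `B` in an odd
number of vertices contribute. -/
theorem energy_add_ind_sub (G : SimpleGraph V) [DecidableRel G.Adj] (B : Finset V)
    (z : V → Fin 2) :
    energy G (z + ind B) - energy G z =
      ∑ v ∈ B, ∑ u ∈ G.neighborFinset v \ B, chi {v, u} z
        + ∑ w ∈ oddCenters G B, -(1 / 2) * chi (closedNbhd G w) z := by
  have hstar : ∀ w, 1 / 4 * chi (closedNbhd G w) (z + ind B) - 1 / 4 * chi (closedNbhd G w) z =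
      if Odd (closedNbhd G w ∩ B).card then -(1 / 2) * chi (closedNbhd G w) z else 0 := by
    intro w
    rw [chi_add_ind]
    split_ifs with h
    · rw [h.neg_one_pow]; ring
    · rw [(Nat.not_odd_iff_even.mp h).neg_one_pow]; ring
  have hpair : ∀ v u, G.Adj v u → 1 / 4 * chi {v, u} z - 1 / 4 * chi {v, u} (z + ind B) =
      (if v ∈ B ∧ u ∉ B then 1 / 2 * chi {v, u} z else 0) +
      (if u ∈ B ∧ v ∉ B then 1 / 2 * chi {u, v} z else 0) := by
    intro v u h
    rw [Finset.pair_comm u v, chi_pair h.ne, chi_pair h.ne]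
    by_cases hv : v ∈ B <;> by_cases hu : u ∈ B <;>
      simp [spin_add, ind, hv, hu] <;> ring_nf
  have hsum : ∀ f : V → V → ℝ, ∑ v, ∑ u ∈ G.neighborFinset v, f v u =
      ∑ v, ∑ u, if G.Adj v u then f v u else 0 := by
    intro f
    refine Finset.sum_congr rfl fun v _ => ?_
    rw [← Finset.sum_filter]
    refine Finset.sum_congr ?_ fun _ _ => rfl
    ext u; simp
  have hedge : ∑ v, ∑ u ∈ G.neighborFinset v,
      (1 / 4 * chi {v, u} z - 1 / 4 * chi {v, u} (z + ind B)) =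
      ∑ v ∈ B, ∑ u ∈ G.neighborFinset v \ B, chi {v, u} z := by
    have h1 : ∑ v, ∑ u ∈ G.neighborFinset v,
        (if v ∈ B ∧ u ∉ B then 1 / 2 * chi {v, u} z else 0) =
        1 / 2 * ∑ v ∈ B, ∑ u ∈ G.neighborFinset v \ B, chi {v, u} z := by
      have : ∀ v, ∑ u ∈ G.neighborFinset v,
          (if v ∈ B ∧ u ∉ B then 1 / 2 * chi {v, u} z else 0) =
          if v ∈ B then 1 / 2 * ∑ u ∈ G.neighborFinset v \ B, chi {v, u} z else 0 := by
        intro v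
        by_cases hv : v ∈ B
        · simp only [hv, true_and, if_true]
          rw [← Finset.sum_filter, ← Finset.sdiff_eq_filter, Finset.mul_sum]
        · simp [hv]
      rw [Finset.sum_congr rfl fun v _ => this v, Finset.sum_ite_mem, Finset.univ_inter,
        Finset.mul_sum]
    have h2 : ∑ v, ∑ u ∈ G.neighborFinset v,
        (if u ∈ B ∧ v ∉ B then 1 / 2 * chi {u, v} z else 0) =
        ∑ v, ∑ u ∈ G.neighborFinset v, (if v ∈ B ∧ u ∉ B then 1 / 2 * chi {v, u} z else 0) := by
      rw [hsum, hsum, Finset.sum_comm]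
      simp only [G.adj_comm]
    rw [Finset.sum_congr rfl fun v _ => Finset.sum_congr rfl fun u hu =>
      hpair v u ((G.mem_neighborFinset v u).mp hu)]
    simp only [Finset.sum_add_distrib]
    rw [h2, h1]
    ring
  rw [← hedge, oddCenters, Finset.sum_filter, ← Finset.sum_congr rfl fun w _ => hstar w,
    ← Finset.sum_add_distrib, energy, energy, ← Finset.sum_sub_distrib]
  refine Finset.sum_congr rfl fun v _ => ?_
  rw [Finset.sum_sub_distrib, ← Finset.mul_sum, ← Finset.mul_sum]
  ring

/-- The phase `exp (iθs)`, used for signs `s = ±1`. -/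
def ph (θ s : ℝ) : ℂ := Complex.exp (Complex.I * (θ * s : ℝ))

/-- The phase of a flip, as a product over the edges and stars that it changes. -/
theorem exp_energy_diff (G : SimpleGraph V) [DecidableRel G.Adj] (γ : ℝ) (B : Finset V)
    (z : V → Fin 2) :
    Complex.exp (Complex.I * (γ * (energy G (z + ind B) - energy G z) : ℝ)) =
      (∏ v ∈ B, ∏ u ∈ G.neighborFinset v \ B, ph γ (chi {v, u} z)) *
        ∏ w ∈ oddCenters G B, ph (-(γ / 2)) (chi (closedNbhd G w) z) := by
  simp only [ph, ← Complex.exp_sum]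
  rw [← Complex.exp_add, energy_add_ind_sub]
  congr 1
  push_cast
  simp only [mul_add, Finset.mul_sum]
  congr 1
  refine Finset.sum_congr rfl fun _ _ => ?_
  ring

theorem ph_add_ph_neg (θ s : ℝ) (hs : s = 1 ∨ s = -1) : ph θ s + ph θ (-s) = 2 * Real.cos θ := by
  have h : ph θ 1 + ph θ (-1) = 2 * Real.cos θ := by
    rw [Complex.ofReal_cos, Complex.cos, ph, ph]
    push_cast
    rw [mul_div_cancel₀ _ two_ne_zero, show Complex.I * (↑θ * 1) = (θ : ℂ) * Complex.I by ring,
      show Complex.I * (↑θ * -1) = -(θ : ℂ) * Complex.I by ring]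
  rcases hs with rfl | rfl
  · exact h
  · rw [neg_neg, add_comm]; exact h

theorem mul_ph_add_neg_mul_ph_neg (θ s : ℝ) (hs : s = 1 ∨ s = -1) :
    s * ph θ s + (-s : ℝ) * ph θ (-s) = 2 * (Complex.I * Real.sin θ) := by
  have h : ph θ 1 - ph θ (-1) = 2 * (Complex.I * Real.sin θ) := by
    rw [Complex.ofReal_sin, Complex.sin, ph, ph]
    push_cast
    have hI := Complex.I_mul_I
    rw [show Complex.I * (↑θ * 1) = (θ : ℂ) * Complex.I by ring,
      show Complex.I * (↑θ * -1) = -(θ : ℂ) * Complex.I by ring]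
    linear_combination (Complex.exp (↑θ * Complex.I) - Complex.exp (-↑θ * Complex.I)) * hI
  rcases hs with rfl | rfl
  · rw [← h]; push_cast; ring
  · rw [← h, neg_neg]; push_cast; ring

/-! ### Eliminating private bits from an average -/

theorem sum_add_ind (B : Finset V) (F : (V → Fin 2) → ℂ) : ∑ z, F (z + ind B) = ∑ z, F z :=
  Equiv.sum_comp (Equiv.addRight (ind B)) F

omit [Fintype V] in
theorem add_ind_right_comm (z : V → Fin 2) (A B : Finset V) :
    z + ind A + ind B = z + ind B + ind A := add_right_comm _ _ _

/-- Independent elimination of factors: if the factor `K i` is the only one that sees the bit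
`ρ i`, then it may be replaced by its mean `M i` over that bit. -/
theorem sum_prod_pivot {ι : Type*} [DecidableEq ι] (X : Finset ι) (ρ : ι → V)
    (K M : ι → (V → Fin 2) → ℂ) (g : (V → Fin 2) → ℂ)
    (hg : ∀ i ∈ X, ∀ z, g (z + ind {ρ i}) = g z)
    (hK : ∀ i ∈ X, ∀ j ∈ X, j ≠ i → ∀ z, K j (z + ind {ρ i}) = K j z)
    (hM : ∀ i ∈ X, ∀ z, K i z + K i (z + ind {ρ i}) = 2 * M i z) :
    ∑ z, g z * ∏ i ∈ X, K i z = ∑ z, g z * ∏ i ∈ X, M i z := by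
  induction X using Finset.induction_on generalizing g with
  | empty => simp
  | insert i X hi ih =>
    have hii := Finset.mem_insert_self i X
    have step : ∑ z, g z * ∏ j ∈ insert i X, K j z = ∑ z, (g z * M i z) * ∏ j ∈ X, K j z := by
      have h1 : (2 : ℂ) * ∑ z, g z * ∏ j ∈ insert i X, K j z =
          2 * ∑ z, (g z * M i z) * ∏ j ∈ X, K j z := by
        rw [two_mul]
        nth_rw 2 [← sum_add_ind {ρ i}]
        rw [← Finset.sum_add_distrib, Finset.mul_sum]
        refine Finset.sum_congr rfl fun z _ => ?_
        rw [Finset.prod_insert hi, Finset.prod_insert hi, hg i hii]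
        have : ∏ j ∈ X, K j (z + ind {ρ i}) = ∏ j ∈ X, K j z :=
          Finset.prod_congr rfl fun j hj =>
            hK i hii j (Finset.mem_insert_of_mem hj) (fun h => hi (h ▸ hj)) z
        rw [this]
        linear_combination (g z * ∏ j ∈ X, K j z) * hM i hii z
      exact mul_left_cancel₀ two_ne_zero h1
    rw [step, ih (fun z => g z * M i z)]
    · refine Finset.sum_congr rfl fun z _ => ?_
      rw [Finset.prod_insert hi, mul_assoc]
    · intro j hj z
      have hjX := Finset.mem_insert_of_mem (b := i) hj
      have hij : i ≠ j := fun h => hi (h ▸ hj)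
      have h2 : (2 : ℂ) * M i (z + ind {ρ j}) = 2 * M i z := by
        rw [← hM i hii, ← hM i hii, hK j hjX i hii hij, add_ind_right_comm, hK j hjX i hii hij]
      rw [hg j hjX, mul_left_cancel₀ two_ne_zero h2]
    · intro j hj k hk
      exact hK j (Finset.mem_insert_of_mem hj) k (Finset.mem_insert_of_mem hk)
    · intro j hj
      exact hM j (Finset.mem_insert_of_mem hj)

theorem avg_add_ind (B : Finset V) (F : (V → Fin 2) → ℂ) :
    avg (fun z => F (z + ind B)) = avg F := by
  rw [avg, avg, sum_add_ind]

theorem avg_const (c : ℂ) : avg (fun _ : V → Fin 2 => c) = c := by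
  have : (2 : ℂ) ^ Fintype.card V ≠ 0 := pow_ne_zero _ two_ne_zero
  simp [avg, this]

theorem avg_const_mul (c : ℂ) (F : (V → Fin 2) → ℂ) :
    avg (fun z => c * F z) = c * avg F := by
  rw [avg, avg, ← Finset.mul_sum]; ring

theorem avg_eq_of_add_flip {F G : (V → Fin 2) → ℂ} (w : V)
    (h : ∀ z, F z + F (z + ind {w}) = 2 * G z) : avg F = avg G := by
  have h2 : (2 : ℂ) * ∑ z, F z = 2 * ∑ z, G z := by
    rw [two_mul]
    nth_rw 2 [← sum_add_ind {w}]
    rw [← Finset.sum_add_distrib, Finset.mul_sum]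
    exact Finset.sum_congr rfl fun z _ => h z
  rw [avg, avg, mul_left_cancel₀ two_ne_zero h2]

/-- The case of `sum_prod_pivot` in which each factor is a function of one sign `χ_{T i}`, and
`T i` contains a private vertex `ρ i`: these signs average out independently. -/
theorem avg_prod_chi_pivot {ι : Type*} [DecidableEq ι] (X : Finset ι) (ρ : ι → V)
    (T : ι → Finset V) (κ : ι → ℝ → ℂ) (m : ι → ℂ) (g : (V → Fin 2) → ℂ)
    (hg : ∀ i ∈ X, ∀ z, g (z + ind {ρ i}) = g z)
    (hmem : ∀ i ∈ X, ρ i ∈ T i)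
    (hnot : ∀ i ∈ X, ∀ j ∈ X, j ≠ i → ρ i ∉ T j)
    (hκ : ∀ i ∈ X, κ i 1 + κ i (-1) = 2 * m i) :
    avg (fun z => g z * ∏ i ∈ X, κ i (chi (T i) z)) = (∏ i ∈ X, m i) * avg g := by
  rw [avg, sum_prod_pivot X ρ (fun i z => κ i (chi (T i) z)) (fun i _ => m i) g hg, avg,
    ← Finset.sum_mul]
  · ring
  · intro i hi j hj hji z
    simp only [chi_add_ind_singleton_of_notMem (hnot i hi j hj hji)]
  · intro i hi z
    simp only [chi_add_ind_singleton_of_mem (hmem i hi)]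
    rw [← hκ i hi]
    rcases chi_eq (T i) z with h | h
    · rw [h]
    · rw [h, neg_neg, add_comm]

theorem avg_mul_chi_pivot {w : V} {T : Finset V} (κ : ℝ → ℂ) {m : ℂ} {g : (V → Fin 2) → ℂ}
    (hg : ∀ z, g (z + ind {w}) = g z) (hw : w ∈ T) (hκ : κ 1 + κ (-1) = 2 * m) :
    avg (fun z => g z * κ (chi T z)) = m * avg g := by
  have := avg_prod_chi_pivot {()} (fun _ => w) (fun _ => T) (fun _ => κ) (fun _ => m) g
    (fun _ _ => hg) (fun _ _ => hw) (fun _ _ _ _ h => (h rfl).elim) (fun _ _ => hκ)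
  simpa using this

omit [Fintype V] in
theorem spin_add_ind_self (z : V → Fin 2) (w : V) : spin ((z + ind {w}) w) = - spin (z w) := by
  simp [ind, spin_add]

omit [Fintype V] in
theorem spin_add_ind_of_ne (z : V → Fin 2) {v w : V} (h : v ≠ w) :
    spin ((z + ind {w}) v) = spin (z v) := by
  simp [ind, h]

theorem add_neg_eq_of_sign {s : ℝ} (hs : s = 1 ∨ s = -1) (f : ℝ → ℂ) :
    f s + f (-s) = f 1 + f (-1) := by
  rcases hs with rfl | rfl
  · rfl
  · rw [neg_neg, add_comm]

theorem spin_mul_spin_eq (x y : Fin 2) : spin x * spin y = 1 ∨ spin x * spin y = -1 := by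
  rcases spin_eq x with h | h <;> rcases spin_eq y with h' | h' <;> simp [h, h']

/-- The signs of three edges at a vertex are independent and uniform. -/
theorem avg_three_edges {u a b c : V} (hua : u ≠ a) (hub : u ≠ b) (huc : u ≠ c) (hab : a ≠ b)
    (hac : a ≠ c) (hbc : b ≠ c) (F : ℝ → ℝ → ℝ → ℂ) :
    avg (fun z => F (spin (z u) * spin (z a)) (spin (z u) * spin (z b))
      (spin (z u) * spin (z c))) =
      (F 1 1 1 + F 1 1 (-1) + F 1 (-1) 1 + F 1 (-1) (-1) + F (-1) 1 1 + F (-1) 1 (-1)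
        + F (-1) (-1) 1 + F (-1) (-1) (-1)) / 8 := by
  rw [avg_eq_of_add_flip a (G := fun z => (F 1 (spin (z u) * spin (z b))
      (spin (z u) * spin (z c)) + F (-1) (spin (z u) * spin (z b)) (spin (z u) * spin (z c))) / 2),
    avg_eq_of_add_flip b (G := fun z => (F 1 1 (spin (z u) * spin (z c)) +
      F 1 (-1) (spin (z u) * spin (z c)) + (F (-1) 1 (spin (z u) * spin (z c)) +
      F (-1) (-1) (spin (z u) * spin (z c)))) / 4),
    avg_eq_of_add_flip c (G := fun z => (F 1 1 1 + F 1 1 (-1) + F 1 (-1) 1 + F 1 (-1) (-1)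
      + F (-1) 1 1 + F (-1) 1 (-1) + F (-1) (-1) 1 + F (-1) (-1) (-1)) / 8), avg_const]
  · intro z
    simp only [spin_add_ind_self, spin_add_ind_of_ne z huc, mul_neg]
    have h := fun x y => add_neg_eq_of_sign (spin_mul_spin_eq (z u) (z c)) (F x y)
    linear_combination (h 1 1 + h 1 (-1) + h (-1) 1 + h (-1) (-1)) / 4
  · intro z
    simp only [spin_add_ind_self, spin_add_ind_of_ne z hub, spin_add_ind_of_ne z hbc.symm, mul_neg]
    have h := fun x y =>
      add_neg_eq_of_sign (spin_mul_spin_eq (z u) (z b)) (fun t => F x t y)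
    linear_combination (h 1 (spin (z u) * spin (z c)) + h (-1) (spin (z u) * spin (z c))) / 2
  · intro z
    simp only [spin_add_ind_self, spin_add_ind_of_ne z hua, spin_add_ind_of_ne z hac.symm,
      spin_add_ind_of_ne z hab.symm, mul_neg]
    have h := add_neg_eq_of_sign (spin_mul_spin_eq (z u) (z a))
      (fun t => F t (spin (z u) * spin (z b)) (spin (z u) * spin (z c)))
    linear_combination h

variable {G : SimpleGraph V} [DecidableRel G.Adj]

/-! ### Correlators with an even number of `Y`s -/

/-- The vertices that a walk of length two reaches from `v`; these include `v` itself when `v` has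
a neighbour. -/
def twoSteps (G : SimpleGraph V) [DecidableRel G.Adj] (v : V) : Finset V :=
  Finset.univ.filter fun x => ∃ p, G.Adj v p ∧ G.Adj p x

omit [DecidableEq V] in
theorem mem_twoSteps {v x : V} : x ∈ twoSteps G v ↔ ∃ p, G.Adj v p ∧ G.Adj p x := by
  simp [twoSteps]

omit [DecidableEq V] in
theorem notMem_twoSteps_of_adj (hg : 7 ≤ G.egirth) {v p : V} (h : G.Adj v p) :
    p ∉ twoSteps G v := by
  rw [mem_twoSteps]
  rintro ⟨q, hq, hqp⟩
  exact no_closed_three hg hq hqp h.symm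

omit [DecidableEq V] in
theorem notMem_twoSteps_of_adj_mem (hg : 7 ≤ G.egirth) {v x u : V} (hx : x ∈ twoSteps G v)
    (h : G.Adj x u) : u ∉ twoSteps G v := by
  obtain ⟨p, hp, hpx⟩ := mem_twoSteps.mp hx
  rw [mem_twoSteps]
  rintro ⟨q, hq, hqu⟩
  exact no_closed_five hg hp hpx h hqu.symm hq.symm

omit [DecidableEq V] in
theorem self_mem_twoSteps {v p : V} (h : G.Adj v p) : v ∈ twoSteps G v :=
  mem_twoSteps.mpr ⟨p, h, h.symm⟩

omit [DecidableEq V] in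
theorem exists_adj_of_regular (hreg : G.IsRegularOfDegree 3) (v : V) : ∃ p, G.Adj v p := by
  have : (G.neighborFinset v).card = 3 := hreg v
  obtain ⟨p, hp⟩ := Finset.card_pos.mp (by omega : 0 < (G.neighborFinset v).card)
  exact ⟨p, (G.mem_neighborFinset v p).mp hp⟩

theorem odd_card_pair_inter_twoSteps (hg : 7 ≤ G.egirth) {v x u : V}
    (hx : x ∈ closedNbhd G v) (h : G.Adj x u) : Odd (({x, u} : Finset V) ∩ twoSteps G v).card := by
  rcases Finset.mem_insert.mp hx with rfl | hx
  · rw [Finset.insert_inter_of_mem (self_mem_twoSteps h),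
      Finset.singleton_inter_of_notMem (notMem_twoSteps_of_adj hg h)]
    simp
  · rw [G.mem_neighborFinset] at hx
    rw [Finset.insert_inter_of_notMem (notMem_twoSteps_of_adj hg hx),
      Finset.singleton_inter_of_mem (mem_twoSteps.mpr ⟨x, hx, h⟩)]
    simp

theorem odd_card_closedNbhd_inter_of_mem (hg : 7 ≤ G.egirth) {v w : V}
    (hw : w ∈ twoSteps G v) : Odd (closedNbhd G w ∩ twoSteps G v).card := by
  have : closedNbhd G w ∩ twoSteps G v = {w} := by
    ext x
    simp only [Finset.mem_inter, Finset.mem_insert, G.mem_neighborFinset, Finset.mem_singleton]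
    constructor
    · rintro ⟨rfl | h, hx⟩
      · rfl
      · exact (notMem_twoSteps_of_adj_mem hg hw h hx).elim
    · rintro rfl
      exact ⟨Or.inl rfl, hw⟩
  rw [this]; simp

theorem odd_card_closedNbhd_inter_of_adj (hreg : G.IsRegularOfDegree 3) (hg : 7 ≤ G.egirth)
    {v w : V} (hw : G.Adj v w) : Odd (closedNbhd G w ∩ twoSteps G v).card := by
  have : closedNbhd G w ∩ twoSteps G v = G.neighborFinset w := by
    rw [Finset.insert_inter_of_notMem (notMem_twoSteps_of_adj hg hw), Finset.inter_eq_left]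
    intro x hx
    exact mem_twoSteps.mpr ⟨w, hw, (G.mem_neighborFinset w x).mp hx⟩
  rw [this, G.card_neighborFinset_eq_degree, hreg w]
  decide

/-- Correlators with an even number of `Y`s vanish. Near `v` the graph is bipartite, so flipping
the colour class `twoSteps G v` negates `χ_S` and the energy change; flipping `B` negates the
energy change and, `|B|` being even, fixes `χ_S`. -/
theorem corr_eq_zero_of_even (hreg : G.IsRegularOfDegree 3) (hg : 7 ≤ G.egirth) (γ : ℝ) {v : V}
    {S B : Finset V} (hBv : B ⊆ closedNbhd G v) (hBS : B ⊆ S) (hB : Even B.card)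
    (hS : Odd (S ∩ twoSteps G v).card) : corr (energy G) γ S B = 0 := by
  set W := twoSteps G v
  have hD : ∀ z, energy G (z + ind W + ind B) - energy G (z + ind W) =
      -(energy G (z + ind B) - energy G z) := by
    intro z
    rw [energy_add_ind_sub, energy_add_ind_sub, neg_add, ← Finset.sum_neg_distrib,
      ← Finset.sum_neg_distrib]
    congr 1
    · refine Finset.sum_congr rfl fun x hx => ?_
      rw [← Finset.sum_neg_distrib]
      refine Finset.sum_congr rfl fun u hu => ?_
      have hxu := (G.mem_neighborFinset x u).mp (Finset.mem_sdiff.mp hu).1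
      rw [chi_add_ind, (odd_card_pair_inter_twoSteps hg (hBv hx) hxu).neg_one_pow]
      ring
    · refine Finset.sum_congr rfl fun w hw => ?_
      have hodd : Odd (closedNbhd G w ∩ W).card := by
        have hne : (closedNbhd G w ∩ B).Nonempty :=
          Finset.card_pos.mp (Finset.mem_filter.mp hw).2.pos
        obtain ⟨b, hb⟩ := hne
        obtain ⟨hbw, hbB⟩ := Finset.mem_inter.mp hb
        have hbv := hBv hbB
        simp only [Finset.mem_insert, G.mem_neighborFinset] at hbw hbv
        rcases hbv with rfl | hbv
        · rcases hbw with rfl | hbw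
          · obtain ⟨p, hp⟩ := exists_adj_of_regular hreg b
            exact odd_card_closedNbhd_inter_of_mem hg (self_mem_twoSteps hp)
          · exact odd_card_closedNbhd_inter_of_adj hreg hg hbw.symm
        · rcases hbw with rfl | hbw
          · exact odd_card_closedNbhd_inter_of_adj hreg hg hbv
          · exact odd_card_closedNbhd_inter_of_mem hg (mem_twoSteps.mpr ⟨b, hbv, hbw.symm⟩)
      rw [chi_add_ind, hodd.neg_one_pow]
      ring
  have h1 : corr (energy G) γ S B = - avg fun z => (chi S z : ℂ) *
      Complex.exp (Complex.I * (γ * -(energy G (z + ind B) - energy G z) : ℝ)) := by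
    rw [corr, ← avg_add_ind W, ← neg_one_mul, ← avg_const_mul]
    congr 1
    funext z
    rw [hD, chi_add_ind, hS.neg_one_pow]
    push_cast
    ring
  have h2 : corr (energy G) γ S B = avg fun z => (chi S z : ℂ) *
      Complex.exp (Complex.I * (γ * -(energy G (z + ind B) - energy G z) : ℝ)) := by
    rw [corr, ← avg_add_ind B]
    congr 1
    funext z
    rw [add_ind_add_ind, chi_add_ind, Finset.inter_eq_right.mpr hBS, hB.neg_one_pow, one_mul,
      neg_sub]
  have h3 := h1
  rw [← h2] at h3
  exact self_eq_neg.mp h3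

theorem ph_one (θ : ℝ) : ph θ 1 = Real.cos θ + Complex.I * Real.sin θ := by
  rw [ph, mul_one, mul_comm, Complex.exp_mul_I, Complex.ofReal_cos, Complex.ofReal_sin]; ring

theorem ph_neg_one (θ : ℝ) : ph θ (-1) = Real.cos θ - Complex.I * Real.sin θ := by
  rw [ph, mul_comm, Complex.exp_mul_I]
  push_cast
  rw [mul_neg_one, Complex.cos_neg, Complex.sin_neg]; ring

theorem I_pow_three : Complex.I ^ 3 = -Complex.I := by rw [pow_succ, Complex.I_sq]; ring

theorem I_pow_five : Complex.I ^ 5 = Complex.I := by rw [pow_succ, Complex.I_pow_four]; ring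

/-! ### Correlators with one `Y` -/

omit [DecidableEq V] in
theorem exists_adj_ne (hreg : G.IsRegularOfDegree 3) (w p : V) : ∃ r, G.Adj w r ∧ r ≠ p := by
  have : (G.neighborFinset w).card = 3 := hreg w
  obtain ⟨r, hr, hrp⟩ := Finset.exists_mem_ne (by omega : 1 < (G.neighborFinset w).card) p
  exact ⟨r, (G.mem_neighborFinset w r).mp hr, hrp⟩

theorem mem_closedNbhd {w x : V} : x ∈ closedNbhd G w ↔ x = w ∨ G.Adj w x := by
  simp

theorem oddCenters_singleton (u : V) : oddCenters G {u} = closedNbhd G u := by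
  ext w
  rw [oddCenters, Finset.mem_filter]
  by_cases h : u ∈ closedNbhd G w
  · rw [Finset.inter_singleton_of_mem h]
    simp only [mem_closedNbhd] at h ⊢
    simpa [G.adj_comm, eq_comm] using h
  · rw [Finset.inter_singleton_of_notMem h]
    simp only [mem_closedNbhd] at h ⊢
    simpa [G.adj_comm, eq_comm] using h

theorem exp_energy_diff_singleton (γ : ℝ) (u : V) (z : V → Fin 2) :
    Complex.exp (Complex.I * (γ * (energy G (z + ind {u}) - energy G z) : ℝ)) =
      (∏ w ∈ G.neighborFinset u, ph γ (chi {u, w} z)) * ph (-(γ / 2)) (chi (closedNbhd G u) z) *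
        ∏ w ∈ G.neighborFinset u, ph (-(γ / 2)) (chi (closedNbhd G w) z) := by
  rw [exp_energy_diff, oddCenters_singleton, Finset.prod_singleton,
    Finset.prod_insert (by simp), mul_assoc]
  congr 2
  ext w
  simp only [Finset.mem_sdiff, G.mem_neighborFinset, Finset.mem_singleton, and_iff_left_iff_imp]
  exact fun h => h.ne'

/-- The stars around the neighbours of `u` average out, as each of these neighbours has a
neighbour that no other of the stars and no function of the spins on `B(u)` sees. -/
theorem avg_mul_prod_closedNbhd (hreg : G.IsRegularOfDegree 3) (hg : 7 ≤ G.egirth) (u : V)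
    (κ : V → ℝ → ℂ) (m : V → ℂ) (g : (V → Fin 2) → ℂ)
    (hinv : ∀ r, r ∉ closedNbhd G u → ∀ z, g (z + ind {r}) = g z)
    (hκ : ∀ w ∈ G.neighborFinset u, κ w 1 + κ w (-1) = 2 * m w) :
    avg (fun z => g z * ∏ w ∈ G.neighborFinset u, κ w (chi (closedNbhd G w) z)) =
      (∏ w ∈ G.neighborFinset u, m w) * avg g := by
  choose ρ hρ hρu using fun w => exists_adj_ne hreg w u
  refine avg_prod_chi_pivot _ ρ _ κ m g ?_ (fun w _ => mem_closedNbhd.mpr (Or.inr (hρ w))) ?_ hκ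
  · intro w hw
    rw [G.mem_neighborFinset] at hw
    refine hinv _ fun h => ?_
    rcases mem_closedNbhd.mp h with h | h
    · exact hρu w h
    · exact no_closed_three hg hw (hρ w) h.symm
  · intro w hw w' hw' hne h
    rw [G.mem_neighborFinset] at hw hw'
    rcases mem_closedNbhd.mp h with h | h
    · exact no_closed_three hg hw (h ▸ hρ w) hw'.symm
    · exact no_closed_four hg hw (hρ w) h.symm hw'.symm (hρu w).symm hne.symm

theorem exists_neighbors (hreg : G.IsRegularOfDegree 3) (u : V) :
    ∃ a b c, a ≠ b ∧ a ≠ c ∧ b ≠ c ∧ G.neighborFinset u = {a, b, c} :=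
  Finset.card_eq_three.mp (hreg u)

theorem ne_of_neighborFinset_eq {u a b c : V} (h : G.neighborFinset u = {a, b, c}) :
    u ≠ a ∧ u ≠ b ∧ u ≠ c := by
  have : ∀ x ∈ ({a, b, c} : Finset V), u ≠ x := fun x hx => by
    rw [← h, G.mem_neighborFinset] at hx
    exact hx.ne
  simpa using this

theorem chi_closedNbhd {u a b c : V} (hab : a ≠ b) (hac : a ≠ c) (hbc : b ≠ c)
    (h : G.neighborFinset u = {a, b, c}) (z : V → Fin 2) :
    chi (closedNbhd G u) z =
      spin (z u) * spin (z a) * (spin (z u) * spin (z b)) * (spin (z u) * spin (z c)) := by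
  obtain ⟨hua, hub, huc⟩ := ne_of_neighborFinset_eq h
  rw [closedNbhd, h, chi, Finset.prod_insert (by simp [hua, hub, huc]),
    Finset.prod_insert (by simp [hab, hac]), Finset.prod_pair hbc]
  linear_combination -(spin (z u) * spin (z a) * spin (z b) * spin (z c)) * spin_mul_self (z u)

/-- The phase from the three edges and the star at a vertex, as a function of the edge signs `a`,
`b`, `c`; the star sign is their product because the centre occurs in it three times. -/
def starPhase (γ a b c : ℝ) : ℂ := ph γ a * ph γ b * ph γ c * ph (-(γ / 2)) (a * b * c)

theorem prod_ph_mul_ph_eq_starPhase {u a b c : V} (hab : a ≠ b) (hac : a ≠ c) (hbc : b ≠ c)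
    (h : G.neighborFinset u = {a, b, c}) (γ : ℝ) (z : V → Fin 2) :
    (∏ w ∈ G.neighborFinset u, ph γ (chi {u, w} z)) * ph (-(γ / 2)) (chi (closedNbhd G u) z) =
      starPhase γ (spin (z u) * spin (z a)) (spin (z u) * spin (z b))
        (spin (z u) * spin (z c)) := by
  obtain ⟨hua, hub, huc⟩ := ne_of_neighborFinset_eq h
  rw [chi_closedNbhd hab hac hbc h, h, Finset.prod_insert (by simp [hab, hac]),
    Finset.prod_pair hbc, chi_pair hua, chi_pair hub, chi_pair huc, starPhase]
  ring

theorem chi_pair_add_ind {u w r : V} (hr : r ∉ closedNbhd G u) (hw : w ∈ G.neighborFinset u)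
    (z : V → Fin 2) : chi {u, w} (z + ind {r}) = chi {u, w} z := by
  refine chi_add_ind_singleton_of_notMem (fun h => hr ?_) z
  rcases Finset.mem_insert.mp h with rfl | h
  · exact Finset.mem_insert_self _ _
  · rw [Finset.mem_singleton.mp h]; exact Finset.mem_insert_of_mem hw

theorem prod_ph_mul_ph_add_ind {u r : V} (hr : r ∉ closedNbhd G u) (γ : ℝ) (z : V → Fin 2) :
    (∏ w ∈ G.neighborFinset u, ph γ (chi {u, w} (z + ind {r}))) *
        ph (-(γ / 2)) (chi (closedNbhd G u) (z + ind {r})) =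
      (∏ w ∈ G.neighborFinset u, ph γ (chi {u, w} z)) *
        ph (-(γ / 2)) (chi (closedNbhd G u) z) := by
  rw [chi_add_ind_singleton_of_notMem hr]
  congr 1
  exact Finset.prod_congr rfl fun w hw => by rw [chi_pair_add_ind hr hw]

theorem corr_singleton_of_subset (hreg : G.IsRegularOfDegree 3) (hg : 7 ≤ G.egirth) (γ : ℝ)
    {u : V} {S : Finset V} (hS : S ⊆ closedNbhd G u) :
    corr (energy G) γ S {u} = (Real.cos (γ / 2) : ℂ) ^ 3 * avg fun z => (chi S z : ℂ) *
      ((∏ w ∈ G.neighborFinset u, ph γ (chi {u, w} z)) *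
        ph (-(γ / 2)) (chi (closedNbhd G u) z)) := by
  simp only [corr, exp_energy_diff_singleton]
  have := avg_mul_prod_closedNbhd hreg hg u (fun _ => ph (-(γ / 2))) (fun _ => Real.cos (γ / 2))
    (fun z => (chi S z : ℂ) * ((∏ w ∈ G.neighborFinset u, ph γ (chi {u, w} z)) *
        ph (-(γ / 2)) (chi (closedNbhd G u) z))) ?_ ?_
  · rw [Finset.prod_const, G.card_neighborFinset_eq_degree, hreg u] at this
    rw [← this]
    congr 1
    funext z
    ring
  · intro r hr z
    rw [chi_add_ind_singleton_of_notMem (fun h => hr (hS h)), prod_ph_mul_ph_add_ind hr]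
  · intro w _
    rw [ph_add_ph_neg _ _ (Or.inl rfl), Real.cos_neg]

/-- The neighbours of `u`, listed with a given one first. -/
theorem exists_neighbors_of_adj (hreg : G.IsRegularOfDegree 3) {u w : V} (h : G.Adj u w) :
    ∃ b c, w ≠ b ∧ w ≠ c ∧ b ≠ c ∧ G.neighborFinset u = {w, b, c} := by
  obtain ⟨a, b, c, hab, hac, hbc, hN⟩ : ∃ a b c, a ≠ b ∧ a ≠ c ∧ b ≠ c ∧
      G.neighborFinset u = {a, b, c} := exists_neighbors hreg u
  have hw : w ∈ ({a, b, c} : Finset V) := by rw [← hN]; simpa using h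
  simp only [Finset.mem_insert, Finset.mem_singleton] at hw
  rcases hw with rfl | rfl | rfl
  · exact ⟨b, c, hab, hac, hbc, hN⟩
  · exact ⟨a, c, hab.symm, hbc, hac, by rw [hN, Finset.insert_comm]⟩
  · exact ⟨a, b, hac.symm, hbc.symm, hab, by
      rw [hN, Finset.pair_comm b, Finset.insert_comm]⟩

theorem corr_edge (hreg : G.IsRegularOfDegree 3) (hg : 7 ≤ G.egirth) (γ : ℝ) {u w : V}
    (h : G.Adj u w) : corr (energy G) γ {u, w} {u} =
      Complex.I * (Real.cos (γ / 2) ^ 4 * Real.sin γ * Real.cos γ : ℝ) := by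
  obtain ⟨b, c, hab, hac, hbc, hN⟩ := exists_neighbors_of_adj hreg h
  obtain ⟨hua, hub, huc⟩ := ne_of_neighborFinset_eq hN
  rw [corr_singleton_of_subset hreg hg γ (by
    intro x hx
    simp only [Finset.mem_insert, Finset.mem_singleton, G.mem_neighborFinset] at hx ⊢
    rcases hx with rfl | rfl
    · exact Or.inl rfl
    · exact Or.inr h)]
  simp only [prod_ph_mul_ph_eq_starPhase hab hac hbc hN, chi_pair hua]
  rw [avg_three_edges hua hub huc hab hac hbc (fun x y t => (x : ℂ) * starPhase γ x y t)]
  simp only [starPhase, mul_one, mul_neg, neg_neg, ph_one, ph_neg_one,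
    Real.cos_neg, Real.sin_neg]
  -- `cos (γ - γ/2)` is what combines the two contributions to the average
  have hc : Real.cos (γ / 2) = Real.cos γ * Real.cos (γ / 2) + Real.sin γ * Real.sin (γ / 2) := by
    rw [← Real.cos_sub]; congr 1; ring
  have hc' := congrArg (fun x : ℝ => (x : ℂ)) hc
  push_cast at hc' ⊢
  generalize Complex.cos γ = cg at *
  generalize Complex.sin γ = sg at *
  generalize Complex.cos (γ / 2) = C at *
  generalize Complex.sin (γ / 2) = S at *
  trans C ^ 3 * (Complex.I * sg * cg * (cg * C + sg * S))
  · ring_nf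
    simp only [I_pow_three]
    ring
  · rw [← hc']; ring

/-- The correlator of the star at `v` with a single `Y`, at the centre. -/
theorem corr_star_center (hreg : G.IsRegularOfDegree 3) (hg : 7 ≤ G.egirth) (γ : ℝ) (v : V) :
    corr (energy G) γ (closedNbhd G v) {v} =
      -(Complex.I * (Real.cos (γ / 2) ^ 3 * (Real.cos (γ / 2) * Real.sin γ ^ 3
        + Real.sin (γ / 2) * Real.cos γ ^ 3) : ℝ)) := by
  obtain ⟨a, b, c, hab, hac, hbc, hN⟩ := exists_neighbors hreg v
  obtain ⟨hua, hub, huc⟩ := ne_of_neighborFinset_eq hN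
  rw [corr_singleton_of_subset hreg hg γ subset_rfl]
  simp only [prod_ph_mul_ph_eq_starPhase hab hac hbc hN]
  simp only [chi_closedNbhd hab hac hbc hN]
  rw [avg_three_edges hua hub huc hab hac hbc
    (fun x y t => ((x * y * t : ℝ) : ℂ) * starPhase γ x y t)]
  simp only [starPhase, mul_one, mul_neg, neg_neg, ph_one, ph_neg_one,
    Real.cos_neg, Real.sin_neg]
  push_cast
  ring_nf
  simp only [I_pow_three]
  ring

/-- The correlator of the star at `v` with a single `Y`, at a neighbour `p` of the centre. The
star sign at `v` is then one of those that average out, and it brings a sine in place of a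
cosine. -/
theorem corr_star_leaf (hreg : G.IsRegularOfDegree 3) (hg : 7 ≤ G.egirth) (γ : ℝ) {v p : V}
    (h : G.Adj v p) :
    corr (energy G) γ (closedNbhd G v) {p} =
      -(Complex.I * (Real.cos (γ / 2) ^ 2 * Real.sin (γ / 2) * (Real.cos (γ / 2) * Real.cos γ ^ 3
        - Real.sin (γ / 2) * Real.sin γ ^ 3) : ℝ)) := by
  obtain ⟨b, c, hab, hac, hbc, hN⟩ := exists_neighbors_of_adj hreg h.symm
  obtain ⟨hua, hub, huc⟩ := ne_of_neighborFinset_eq hN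
  simp only [corr, exp_energy_diff_singleton]
  have key := avg_mul_prod_closedNbhd hreg hg p
    (fun w s => if w = v then (s : ℂ) * ph (-(γ / 2)) s else ph (-(γ / 2)) s)
    (fun w => if w = v then Complex.I * Real.sin (-(γ / 2)) else Real.cos (γ / 2))
    (fun z => (∏ w ∈ G.neighborFinset p, ph γ (chi {p, w} z)) *
        ph (-(γ / 2)) (chi (closedNbhd G p) z)) ?_ ?_
  · have hprod : ∀ z, (chi (closedNbhd G v) z : ℂ) *
        ((∏ w ∈ G.neighborFinset p, ph γ (chi {p, w} z)) * ph (-(γ / 2)) (chi (closedNbhd G p) z) *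
        ∏ w ∈ G.neighborFinset p, ph (-(γ / 2)) (chi (closedNbhd G w) z)) =
        ((∏ w ∈ G.neighborFinset p, ph γ (chi {p, w} z)) *
        ph (-(γ / 2)) (chi (closedNbhd G p) z)) *
        ∏ w ∈ G.neighborFinset p, (if w = v then
          (chi (closedNbhd G w) z : ℂ) * ph (-(γ / 2)) (chi (closedNbhd G w) z)
          else ph (-(γ / 2)) (chi (closedNbhd G w) z)) := by
      intro z
      rw [hN]
      simp only [Finset.prod_insert (show v ∉ ({b, c} : Finset V) by simp [hab, hac]),
        Finset.prod_pair hbc, if_true, if_neg hab.symm, if_neg hac.symm]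
      ring
    simp only [hprod, key]
    simp only [prod_ph_mul_ph_eq_starPhase hab hac hbc hN]
    rw [avg_three_edges hua hub huc hab hac hbc (fun x y t => starPhase γ x y t), hN]
    simp only [Finset.prod_insert (show v ∉ ({b, c} : Finset V) by simp [hab, hac]),
        Finset.prod_pair hbc, if_true, if_neg hab.symm, if_neg hac.symm]
    simp only [starPhase, mul_one, mul_neg, neg_neg, ph_one, ph_neg_one,
      Real.cos_neg, Real.sin_neg]
    push_cast
    ring_nf
    rw [I_pow_five]
  · intro r hr z
    exact prod_ph_mul_ph_add_ind hr γ z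
  · intro w _
    by_cases hw : w = v
    · simp only [hw, if_true]
      have := mul_ph_add_neg_mul_ph_neg (-(γ / 2)) 1 (Or.inl rfl)
      simpa using this
    · simp only [hw, if_false]
      rw [ph_add_ph_neg _ _ (Or.inl rfl), Real.cos_neg]

omit [Fintype V] [DecidableRel G.Adj] in
/-- A third-level vertex `r` of the tree around `v` has no neighbour up to the second level except
its parent `q`. This is where girth seven is used. -/
theorem not_adj_of_third_step (hg : 7 ≤ G.egirth) {v p q r : V} (hp : G.Adj v p) (hq : G.Adj p q)
    (hqv : q ≠ v) (hr : G.Adj q r) (hrp : r ≠ p) :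
    ¬ G.Adj v r ∧ (∀ p', G.Adj v p' → ¬ G.Adj p' r) ∧
      ∀ p' q', G.Adj v p' → G.Adj p' q' → q' ≠ v → q' ≠ q → ¬ G.Adj q' r := by
  refine ⟨fun h => no_closed_four hg hp hq hr h.symm hqv.symm hrp.symm,
    fun p' hp' h => no_closed_five hg hp hq hr h.symm hp'.symm, fun p' q' hp' hq' hqv' hne h => ?_⟩
  by_cases hpp : p = p'
  · subst hpp
    exact no_closed_four hg hq hr h.symm hq'.symm hrp.symm hne.symm
  · refine no_closed_six hg hp hq hr h.symm hq'.symm hp'.symm hqv.symm hrp.symm hne.symm ?_ hqv'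
      (Ne.symm hpp)
    rintro rfl
    exact no_closed_four hg hp hq hr hp'.symm hqv.symm hpp

/-! ### Correlators with three `Y`s -/

omit [Fintype V] in
theorem card_inter_triple (T : Finset V) {a b c : V} (hab : a ≠ b) (hac : a ≠ c) (hbc : b ≠ c) :
    (T ∩ {a, b, c}).card =
      (if a ∈ T then 1 else 0) + ((if b ∈ T then 1 else 0) + (if c ∈ T then 1 else 0)) := by
  rw [Finset.inter_comm, ← Finset.filter_mem_eq_inter, Finset.card_filter,
    Finset.sum_insert (by simp [hab, hac]), Finset.sum_pair hbc]

theorem adj_of_neighborFinset_eq {u a b c : V} (h : G.neighborFinset u = {a, b, c}) :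
    G.Adj u a ∧ G.Adj u b ∧ G.Adj u c := by
  simp only [← G.mem_neighborFinset, h]; simp

theorem oddCenters_center_and_two (hg : 7 ≤ G.egirth) {v a b c : V} (hab : a ≠ b) (hac : a ≠ c)
    (hbc : b ≠ c) (hN : G.neighborFinset v = {a, b, c}) :
    oddCenters G {v, a, b} = insert v (insert c
      ((G.neighborFinset a).erase v ∪ (G.neighborFinset b).erase v)) := by
  obtain ⟨hva, hvb, hvc⟩ := adj_of_neighborFinset_eq hN
  have hadj : ∀ w, G.Adj v w ↔ w = a ∨ w = b ∨ w = c := fun w => by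
    rw [← G.mem_neighborFinset, hN]; simp
  have nab : ¬ G.Adj a b := fun h => no_closed_three hg hva h hvb.symm
  have nac : ¬ G.Adj a c := fun h => no_closed_three hg hva h hvc.symm
  have nbc : ¬ G.Adj b c := fun h => no_closed_three hg hvb h hvc.symm
  ext w
  rw [oddCenters, Finset.mem_filter, card_inter_triple _ hva.ne hvb.ne hab]
  simp only [Finset.mem_univ, true_and, Finset.mem_insert, Finset.mem_union,
    Finset.mem_erase, G.mem_neighborFinset]
  by_cases hwv : w = v
  · subst hwv; simp [hva, hvb]; decide
  by_cases hwa : w = a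
  · subst hwa; simp [hva.symm, hva.ne', nab, hac, hab.symm, G.adj_comm b w]
  by_cases hwb : w = b
  · subst hwb
    simp [hvb.symm, hvb.ne', nab, hab, hbc, G.adj_comm w a]
  by_cases hwc : w = c
  · subst hwc
    simp [hvc.symm, hvc.ne', nac, nbc, hac, hbc, G.adj_comm w a, G.adj_comm w b]
  have hnv : ¬ G.Adj w v := fun h => by
    rcases (hadj w).mp h.symm with h | h | h <;> contradiction
  have hnot : ¬ (G.Adj w a ∧ G.Adj w b) := fun h =>
    no_closed_four hg hva h.1.symm h.2 hvb.symm (Ne.symm hwv) hab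
  by_cases h1 : G.Adj w a <;> by_cases h2 : G.Adj w b
  · exact (hnot ⟨h1, h2⟩).elim
  · simp [hwv, hwc, hnv, h1, h2, h1.symm, Ne.symm hwv, Ne.symm hwa, Ne.symm hwb]
  · simp [hwv, hwc, hnv, h1, h2, h2.symm, Ne.symm hwv, Ne.symm hwa, Ne.symm hwb]
  · simp [hwv, hwc, hnv, h1, h2, G.adj_comm a w, G.adj_comm b w, Ne.symm hwv, Ne.symm hwa,
      Ne.symm hwb]

theorem oddCenters_neighborFinset (hg : 7 ≤ G.egirth) {v a b c : V} (hab : a ≠ b) (hac : a ≠ c)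
    (hbc : b ≠ c) (hN : G.neighborFinset v = {a, b, c}) :
    oddCenters G (G.neighborFinset v) = insert v (G.neighborFinset v ∪
      (G.neighborFinset v).biUnion fun p => (G.neighborFinset p).erase v) := by
  obtain ⟨hva, hvb, hvc⟩ := adj_of_neighborFinset_eq hN
  have hadj : ∀ w, G.Adj v w ↔ w = a ∨ w = b ∨ w = c := fun w => by
    rw [← G.mem_neighborFinset, hN]; simp
  have nab : ¬ G.Adj a b := fun h => no_closed_three hg hva h hvb.symm
  have nac : ¬ G.Adj a c := fun h => no_closed_three hg hva h hvc.symm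
  have nbc : ¬ G.Adj b c := fun h => no_closed_three hg hvb h hvc.symm
  ext w
  rw [oddCenters, Finset.mem_filter, hN, card_inter_triple _ hab hac hbc]
  simp only [Finset.mem_univ, true_and, Finset.mem_insert, Finset.mem_union,
    Finset.mem_erase, G.mem_neighborFinset, Finset.mem_biUnion, Finset.mem_singleton,
    exists_eq_or_imp, exists_eq_left]
  by_cases hwv : w = v
  · subst hwv; simp [hva, hvb, hvc]; decide
  by_cases hwa : w = a
  · subst hwa; simp [nab, nac, hab.symm, hac.symm]
  by_cases hwb : w = b
  · subst hwb; simp [nab, nbc, hab, hbc.symm, G.adj_comm w a]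
  by_cases hwc : w = c
  · subst hwc; simp [nac, nbc, hac, hbc, G.adj_comm w a, G.adj_comm w b]
  have four : ∀ x y, G.Adj v x → G.Adj v y → x ≠ y → G.Adj w x → ¬ G.Adj w y :=
    fun x y hx hy hxy h h' => no_closed_four hg hx h.symm h' hy.symm (Ne.symm hwv) hxy
  have f1 := four a b hva hvb hab
  have f2 := four a c hva hvc hac
  have f3 := four b c hvb hvc hbc
  by_cases h1 : G.Adj w a <;> by_cases h2 : G.Adj w b <;> by_cases h3 : G.Adj w c <;>
    simp [h1, h2, h3] at f1 f2 f3 <;>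
    simp [hwv, hwa, hwb, hwc, h1, h2, h3, Ne.symm hwa, Ne.symm hwb, Ne.symm hwc,
      G.adj_comm a w, G.adj_comm b w, G.adj_comm c w]

theorem neighborFinset_sdiff_eq_erase (hg : 7 ≤ G.egirth) {v x a b : V} (hx : G.Adj v x)
    (ha : G.Adj v a) (hb : G.Adj v b) :
    G.neighborFinset x \ {v, a, b} = (G.neighborFinset x).erase v := by
  ext w
  simp only [Finset.mem_sdiff, G.mem_neighborFinset, Finset.mem_insert, Finset.mem_singleton,
    Finset.mem_erase, not_or]
  constructor
  · rintro ⟨h, h', -⟩; exact ⟨h', h⟩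
  · rintro ⟨h', h⟩
    refine ⟨h, h', ?_, ?_⟩
    · rintro rfl; exact no_closed_three hg hx h ha.symm
    · rintro rfl; exact no_closed_three hg hx h hb.symm

theorem card_neighborFinset_erase (hreg : G.IsRegularOfDegree 3) {v p : V} (h : G.Adj v p) :
    ((G.neighborFinset p).erase v).card = 2 := by
  rw [Finset.card_erase_of_mem (by simpa using h.symm), G.card_neighborFinset_eq_degree, hreg p]

theorem disjoint_neighborFinset_erase (hg : 7 ≤ G.egirth) {v a b : V} (ha : G.Adj v a)
    (hb : G.Adj v b) (hab : a ≠ b) :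
    Disjoint ((G.neighborFinset a).erase v) ((G.neighborFinset b).erase v) := by
  rw [Finset.disjoint_left]
  intro q hqa hqb
  simp only [Finset.mem_erase, G.mem_neighborFinset] at hqa hqb
  exact no_closed_four hg ha hqa.2 hqb.2.symm hb.symm hqa.1.symm hab

theorem notMem_closedNbhd_of_mem_erase (hg : 7 ≤ G.egirth) {v p q : V} (hp : G.Adj v p)
    (hq : q ∈ (G.neighborFinset p).erase v) : q ∉ closedNbhd G v := by
  simp only [Finset.mem_erase, G.mem_neighborFinset] at hq
  rw [mem_closedNbhd]
  rintro (h | h)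
  · exact hq.1 h
  · exact no_closed_three hg hp hq.2 h.symm

/-- The edges from a neighbour `p` of `v` to the second level average out. -/
theorem avg_mul_prod_edges (hreg : G.IsRegularOfDegree 3) (γ : ℝ) {v p : V}
    (hp : G.Adj v p) {g : (V → Fin 2) → ℂ}
    (hinv : ∀ q ∈ (G.neighborFinset p).erase v, ∀ z, g (z + ind {q}) = g z) :
    avg (fun z => g z * ∏ q ∈ (G.neighborFinset p).erase v, ph γ (chi {p, q} z)) =
      (Real.cos γ : ℂ) ^ 2 * avg g := by
  rw [avg_prod_chi_pivot _ (fun q => q) (fun q => {p, q}) (fun _ => ph γ) (fun _ => Real.cos γ) g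
    hinv, Finset.prod_const, card_neighborFinset_erase hreg hp]
  · intro q _; simp
  · intro q hq q' _ hne h
    rcases Finset.mem_insert.mp h with h | h
    · rw [h] at hq; simp at hq
    · exact hne (Finset.mem_singleton.mp h).symm
  · intro q _
    rw [ph_add_ph_neg _ _ (Or.inl rfl)]

/-- The correlator of the star at `v` with `Y` at the centre and at two neighbours. All the signs
involved are independent: four edges and four stars beyond `a` and `b`, the edge from `v` to `c`,
and the stars at `c` and `v`. -/
theorem corr_star_center_and_two (hreg : G.IsRegularOfDegree 3) (hg : 7 ≤ G.egirth) (γ : ℝ)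
    {v a b c : V} (hab : a ≠ b) (hac : a ≠ c) (hbc : b ≠ c)
    (hN : G.neighborFinset v = {a, b, c}) :
    corr (energy G) γ (closedNbhd G v) {v, a, b} =
      -(Complex.I * (Real.sin (γ / 2) * Real.cos γ ^ 5 * Real.cos (γ / 2) ^ 5 : ℝ)) := by
  obtain ⟨hva, hvb, hvc⟩ := adj_of_neighborFinset_eq hN
  have hdisj := disjoint_neighborFinset_erase hg hva hvb hab
  set A := (G.neighborFinset a).erase v with hA
  set B := (G.neighborFinset b).erase v with hB
  have hAv : ∀ q ∈ A, q ∉ closedNbhd G v := fun q => notMem_closedNbhd_of_mem_erase hg hva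
  have hBv : ∀ q ∈ B, q ∉ closedNbhd G v := fun q => notMem_closedNbhd_of_mem_erase hg hvb
  have hcv : c ∈ closedNbhd G v := mem_closedNbhd.mpr (Or.inr hvc)
  have hbv : b ∈ closedNbhd G v := mem_closedNbhd.mpr (Or.inr hvb)
  have hav : a ∈ closedNbhd G v := mem_closedNbhd.mpr (Or.inr hva)
  have hvv : v ∈ closedNbhd G v := mem_closedNbhd.mpr (Or.inl rfl)
  have hcAB : c ∉ A ∪ B := fun h => (Finset.mem_union.mp h).elim (fun h => hAv c h hcv)
    (fun h => hBv c h hcv)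
  have hvX : v ∉ insert c (A ∪ B) := by
    simp [hvc.ne, hA, hB]
  have hvc' : G.neighborFinset v \ {v, a, b} = {c} := by
    rw [hN]; ext w
    simp only [Finset.mem_sdiff, Finset.mem_insert, Finset.mem_singleton, not_or]
    constructor
    · rintro ⟨h | h | h, h1, h2, h3⟩ <;> first | contradiction | exact h
    · rintro rfl; exact ⟨by simp, hvc.ne', hac.symm, hbc.symm⟩
  set E : (V → Fin 2) → ℂ := fun z =>
    (chi (closedNbhd G v) z : ℂ) * ph (-(γ / 2)) (chi (closedNbhd G v) z) with hE
  have hEinv : ∀ r, r ∉ closedNbhd G v → ∀ z, E (z + ind {r}) = E z := fun r hr z => by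
    simp only [hE, chi_add_ind_singleton_of_notMem hr]
  have hcinv : ∀ r, r ∉ closedNbhd G v → ∀ z, chi {v, c} (z + ind {r}) = chi {v, c} z := by
    intro r hr z
    refine chi_add_ind_singleton_of_notMem (fun h => hr ?_) z
    rcases Finset.mem_insert.mp h with rfl | h
    · exact hvv
    · rwa [Finset.mem_singleton.mp h]
  have hedge : ∀ p, p ∈ closedNbhd G v → ∀ r, r ∉ closedNbhd G v →
      ∀ Q : Finset V, r ∉ Q → ∀ z, ∏ q ∈ Q, ph γ (chi {p, q} (z + ind {r})) =
        ∏ q ∈ Q, ph γ (chi {p, q} z) := by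
    intro p hp r hr Q hrQ z
    refine Finset.prod_congr rfl fun q hq => ?_
    rw [chi_add_ind_singleton_of_notMem]
    intro h
    rcases Finset.mem_insert.mp h with rfl | h
    · exact hr hp
    · exact hrQ (by rwa [Finset.mem_singleton.mp h])
  -- a private vertex for every star other than the one at `v`: one step further away from `v`
  have hpivot : ∀ w ∈ insert c (A ∪ B), ∃ r, r ∈ closedNbhd G w ∧ r ∉ closedNbhd G v ∧
      r ∉ A ∧ r ∉ B ∧ ∀ w' ∈ insert c (A ∪ B), w' ≠ w → r ∉ closedNbhd G w' := by
    intro w hw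
    have hAB : ∀ q ∈ A ∪ B, ∃ p, G.Adj v p ∧ G.Adj p q ∧ q ≠ v ∧ p ≠ c := by
      intro q hq
      rcases Finset.mem_union.mp hq with h | h
      · simp only [hA, Finset.mem_erase, G.mem_neighborFinset] at h
        exact ⟨a, hva, h.2, h.1, hac⟩
      · simp only [hB, Finset.mem_erase, G.mem_neighborFinset] at h
        exact ⟨b, hvb, h.2, h.1, hbc⟩
    rcases Finset.mem_insert.mp hw with rfl | hw
    · obtain ⟨r, hr, hrv⟩ := exists_adj_ne hreg w v
      have hnr : ∀ p, G.Adj v p → p ≠ w → ¬ G.Adj p r := fun p hp hpw h =>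
        no_closed_four hg hp h hr.symm hvc.symm hrv.symm hpw
      refine ⟨r, mem_closedNbhd.mpr (Or.inr hr), ?_, ?_, ?_, ?_⟩
      · rw [mem_closedNbhd]
        rintro (h | h)
        · exact hrv h
        · exact no_closed_three hg hvc hr h.symm
      · simp [hA, hnr a hva hac]
      · simp [hB, hnr b hvb hbc]
      · intro w' hw' hne h
        obtain ⟨p, hp, hpq, hqv, hpc⟩ :=
          hAB w' ((Finset.mem_insert.mp hw').resolve_left hne)
        rcases mem_closedNbhd.mp h with rfl | h
        · exact hnr p hp hpc hpq
        · exact no_closed_five hg hp hpq h hr.symm hvc.symm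
    · obtain ⟨p, hp, hpq, hqv, hpc⟩ := hAB w hw
      obtain ⟨r, hr, hrp⟩ := exists_adj_ne hreg w p
      obtain ⟨h1, h2, h3⟩ := not_adj_of_third_step hg hp hpq hqv hr hrp
      refine ⟨r, mem_closedNbhd.mpr (Or.inr hr), ?_, ?_, ?_, ?_⟩
      · rw [mem_closedNbhd]
        rintro (rfl | h)
        · exact h2 p hp hp.symm
        · exact h1 h
      · simp [hA, h2 a hva]
      · simp [hB, h2 b hvb]
      · intro w' hw' hne h
        rcases Finset.mem_insert.mp hw' with rfl | hw'
        · rcases mem_closedNbhd.mp h with rfl | h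
          · exact h1 hvc
          · exact h2 _ hvc h
        · obtain ⟨p', hp', hpq', hqv', -⟩ := hAB w' hw'
          rcases mem_closedNbhd.mp h with rfl | h
          · exact h2 p' hp' hpq'
          · exact h3 p' w' hp' hpq' hqv' hne h
  choose! ρ hρ1 hρ2 hρ3 hρ4 hρ5 using hpivot
  have hstep1 := avg_prod_chi_pivot (insert c (A ∪ B)) ρ (fun w => closedNbhd G w)
    (fun _ => ph (-(γ / 2))) (fun _ => Real.cos (γ / 2))
    (fun z => (E z * ph γ (chi {v, c} z) * ∏ q ∈ B, ph γ (chi {b, q} z)) *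
      ∏ q ∈ A, ph γ (chi {a, q} z)) (by
      intro w hw z
      rw [hEinv _ (hρ2 w hw), hcinv _ (hρ2 w hw), hedge a hav _ (hρ2 w hw) A (hρ3 w hw),
        hedge b hbv _ (hρ2 w hw) B (hρ4 w hw)])
    hρ1 hρ5 (by
      intro w _
      rw [ph_add_ph_neg _ _ (Or.inl rfl), Real.cos_neg])
  have hstep2 := avg_mul_prod_edges hreg γ hva
    (g := fun z => E z * ph γ (chi {v, c} z) * ∏ q ∈ B, ph γ (chi {b, q} z)) (by
      intro q hq z
      rw [hEinv _ (hAv q hq), hcinv _ (hAv q hq),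
        hedge b hbv _ (hAv q hq) B (Finset.disjoint_left.mp hdisj hq)])
  have hstep3 := avg_mul_prod_edges hreg γ hvb
    (g := fun z => E z * ph γ (chi {v, c} z)) (by
      intro q hq z
      rw [hEinv _ (hBv q hq), hcinv _ (hBv q hq)])
  -- the star at `v` shares `c` with the edge `{v, c}`, so it goes first, by way of its vertex `a`
  have hstep4 := avg_mul_chi_pivot (w := a) (T := closedNbhd G v)
    (fun s => (s : ℂ) * ph (-(γ / 2)) s) (m := Complex.I * Real.sin (-(γ / 2)))
    (g := fun z => ph γ (chi {v, c} z)) (by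
      intro z
      rw [chi_add_ind_singleton_of_notMem (by simp [hva.ne', hac])]) hav
    (by simpa using mul_ph_add_neg_mul_ph_neg (-(γ / 2)) 1 (Or.inl rfl))
  have hstep5 := avg_mul_chi_pivot (w := c) (T := {v, c}) (ph γ) (m := Real.cos γ)
    (g := fun _ => 1) (fun _ => rfl) (by simp) (ph_add_ph_neg _ _ (Or.inl rfl))
  have hcard : (insert c (A ∪ B)).card = 5 := by
    rw [Finset.card_insert_of_notMem hcAB, Finset.card_union_of_disjoint hdisj,
      card_neighborFinset_erase hreg hva, card_neighborFinset_erase hreg hvb]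
  have hcorr : corr (energy G) γ (closedNbhd G v) {v, a, b} =
      avg fun z => (E z * ph γ (chi {v, c} z) * ∏ q ∈ B, ph γ (chi {b, q} z)) *
        (∏ q ∈ A, ph γ (chi {a, q} z)) *
        ∏ w ∈ insert c (A ∪ B), ph (-(γ / 2)) (chi (closedNbhd G w) z) := by
    rw [corr]
    congr 1
    funext z
    rw [exp_energy_diff, oddCenters_center_and_two hg hab hac hbc hN, ← hA, ← hB,
      Finset.prod_insert (by simp [hva.ne, hvb.ne]), Finset.prod_pair hab, hvc',
      Finset.prod_singleton, neighborFinset_sdiff_eq_erase hg hva hva hvb,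
      neighborFinset_sdiff_eq_erase hg hvb hva hvb, Finset.prod_insert hvX]
    simp only [hE]
    ring
  have hcomm : (fun z => E z * ph γ (chi {v, c} z)) =
      fun z => ph γ (chi {v, c} z) * E z := by funext z; ring
  rw [hcorr, hstep1, Finset.prod_const, hcard, hstep2, hstep3, hcomm, hstep4]
  simp only [one_mul, avg_const, mul_one] at hstep5
  rw [hstep5, Real.sin_neg]
  push_cast
  ring

theorem avg_prod_pivot {ι : Type*} [DecidableEq ι] (X : Finset ι) (ρ : ι → V)
    (K M : ι → (V → Fin 2) → ℂ) (g : (V → Fin 2) → ℂ)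
    (hg : ∀ i ∈ X, ∀ z, g (z + ind {ρ i}) = g z)
    (hK : ∀ i ∈ X, ∀ j ∈ X, j ≠ i → ∀ z, K j (z + ind {ρ i}) = K j z)
    (hM : ∀ i ∈ X, ∀ z, K i z + K i (z + ind {ρ i}) = 2 * M i z) :
    avg (fun z => g z * ∏ i ∈ X, K i z) = avg fun z => g z * ∏ i ∈ X, M i z := by
  rw [avg, avg, sum_prod_pivot X ρ K M g hg hK hM]

/-- The mean of `starPhase` over two of its edge signs. -/
def branchPhase (γ a : ℝ) : ℂ :=
  (starPhase γ a 1 1 + starPhase γ a 1 (-1) + starPhase γ a (-1) 1 + starPhase γ a (-1) (-1)) / 4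

/-- The two outer edge signs at every `p ∈ X` are averaged, first over the bits of the vertices
`x p` and then over those of the vertices `y p`. -/
theorem avg_mul_prod_starPhase {v : V} {X : Finset V} (x y : V → V) (γ : ℝ)
    (g : (V → Fin 2) → ℂ)
    (hxg : ∀ p ∈ X, ∀ z, g (z + ind {x p}) = g z) (hyg : ∀ p ∈ X, ∀ z, g (z + ind {y p}) = g z)
    (hxv : ∀ p ∈ X, v ≠ x p) (hyv : ∀ p ∈ X, v ≠ y p)
    (hxX : ∀ p ∈ X, ∀ p' ∈ X, p' ≠ x p) (hyX : ∀ p ∈ X, ∀ p' ∈ X, p' ≠ y p)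
    (hxx : ∀ p ∈ X, ∀ p' ∈ X, p' ≠ p → x p' ≠ x p) (hyy : ∀ p ∈ X, ∀ p' ∈ X, p' ≠ p → y p' ≠ y p)
    (hyx : ∀ p ∈ X, ∀ p' ∈ X, y p' ≠ x p) :
    avg (fun z => g z * ∏ p ∈ X, starPhase γ (spin (z p) * spin (z v))
        (spin (z p) * spin (z (x p))) (spin (z p) * spin (z (y p)))) =
      avg (fun z => g z * ∏ p ∈ X, branchPhase γ (spin (z v) * spin (z p))) := by
  rw [avg_prod_pivot X x _ (fun p z => (starPhase γ (spin (z p) * spin (z v)) 1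
      (spin (z p) * spin (z (y p))) + starPhase γ (spin (z p) * spin (z v)) (-1)
      (spin (z p) * spin (z (y p)))) / 2) g hxg,
    avg_prod_pivot X y _ (fun p z => branchPhase γ (spin (z v) * spin (z p))) g hyg]
  · intro p hp p' hp' hne z
    simp only [spin_add_ind_of_ne z (hyX p hp p' hp'), spin_add_ind_of_ne z (hyv p hp),
      spin_add_ind_of_ne z (hyy p hp p' hp' hne)]
  · intro p hp z
    simp only [spin_add_ind_of_ne z (hyX p hp p hp), spin_add_ind_of_ne z (hyv p hp),
      spin_add_ind_self, mul_neg, branchPhase]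
    have h := fun s => add_neg_eq_of_sign (spin_mul_spin_eq (z p) (z (y p)))
      (fun t => starPhase γ (spin (z p) * spin (z v)) s t)
    rw [mul_comm (spin (z v))]
    linear_combination (h 1 + h (-1)) / 2
  · intro p hp p' hp' hne z
    simp only [spin_add_ind_of_ne z (hxX p hp p' hp'), spin_add_ind_of_ne z (hxv p hp),
      spin_add_ind_of_ne z (hxx p hp p' hp' hne), spin_add_ind_of_ne z (hyx p hp p' hp')]
  · intro p hp z
    simp only [spin_add_ind_of_ne z (hxX p hp p hp), spin_add_ind_of_ne z (hxv p hp),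
      spin_add_ind_self, spin_add_ind_of_ne z (hyx p hp p hp), mul_neg]
    have h := add_neg_eq_of_sign (spin_mul_spin_eq (z p) (z (x p)))
      (fun t => starPhase γ (spin (z p) * spin (z v)) t (spin (z p) * spin (z (y p))))
    linear_combination h

theorem branchPhase_eq (γ : ℝ) {a : ℝ} (ha : a = 1 ∨ a = -1) : branchPhase γ a =
    ((Real.cos (γ / 2) * Real.cos γ ^ 3 - Real.sin (γ / 2) * Real.sin γ ^ 3 : ℝ) : ℂ) +
      Complex.I * a * (Real.sin γ * Real.cos γ * Real.cos (γ / 2) : ℝ) := by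
  have hc : Real.cos (γ / 2) = Real.cos γ * Real.cos (γ / 2) + Real.sin γ * Real.sin (γ / 2) := by
    rw [← Real.cos_sub]; congr 1; ring
  have hc' : ((Real.sin γ * Real.cos γ * Real.cos (γ / 2) : ℝ) : ℂ) =
      Real.sin γ * Real.cos γ *
        (Real.cos γ * Real.cos (γ / 2) + Real.sin γ * Real.sin (γ / 2)) := by
    rw [← Complex.ofReal_mul (Real.cos γ), ← Complex.ofReal_mul (Real.sin γ) (Real.sin _),
      ← Complex.ofReal_add, ← hc]
    push_cast; ring
  rw [hc']
  rcases ha with rfl | rfl <;>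
  · simp only [branchPhase, starPhase, mul_one, mul_neg, neg_neg, ph_one, ph_neg_one,
      Real.cos_neg, Real.sin_neg]
    push_cast
    ring_nf
    simp only [I_pow_three, Complex.I_pow_four]
    ring

theorem prod_edges_mul_prod_closedNbhd (hg : 7 ≤ G.egirth) (γ : ℝ) (v : V) (z : V → Fin 2) :
    (∏ p ∈ G.neighborFinset v, ∏ u ∈ G.neighborFinset p \ G.neighborFinset v,
        ph γ (chi {p, u} z)) *
      ∏ p ∈ G.neighborFinset v, ph (-(γ / 2)) (chi (closedNbhd G p) z) =
    ∏ p ∈ G.neighborFinset v, ((∏ u ∈ G.neighborFinset p, ph γ (chi {p, u} z)) *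
      ph (-(γ / 2)) (chi (closedNbhd G p) z)) := by
  rw [← Finset.prod_mul_distrib]
  refine Finset.prod_congr rfl fun p hp => ?_
  rw [G.mem_neighborFinset] at hp
  rw [Finset.sdiff_eq_self_of_disjoint]
  rw [Finset.disjoint_left]
  intro u hu hu'
  rw [G.mem_neighborFinset] at hu hu'
  exact no_closed_three hg hp hu hu'.symm

theorem avg_star_mul_prod_branchPhase (hreg : G.IsRegularOfDegree 3) (γ : ℝ) (v : V) :
    avg (fun z => (chi (closedNbhd G v) z : ℂ) * ph (-(γ / 2)) (chi (closedNbhd G v) z) *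
      ∏ p ∈ G.neighborFinset v, branchPhase γ (spin (z v) * spin (z p))) =
      -(Complex.I * (Real.sin (γ / 2) *
          (Real.cos (γ / 2) * Real.cos γ ^ 3 - Real.sin (γ / 2) * Real.sin γ ^ 3) ^ 3
        + Real.cos (γ / 2) * (Real.sin γ * Real.cos γ * Real.cos (γ / 2)) ^ 3 : ℝ)) := by
  obtain ⟨a, b, c, hab, hac, hbc, hN⟩ := exists_neighbors hreg v
  obtain ⟨hva, hvb, hvc⟩ := ne_of_neighborFinset_eq hN
  have hF : ∀ z : V → Fin 2,
      (chi (closedNbhd G v) z : ℂ) * ph (-(γ / 2)) (chi (closedNbhd G v) z) *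
      ∏ p ∈ G.neighborFinset v, branchPhase γ (spin (z v) * spin (z p)) =
      (fun r s t : ℝ => ((r * s * t : ℝ) : ℂ) * ph (-(γ / 2)) (r * s * t) *
        (branchPhase γ r * (branchPhase γ s * branchPhase γ t)))
        (spin (z v) * spin (z a)) (spin (z v) * spin (z b)) (spin (z v) * spin (z c)) := by
    intro z
    rw [chi_closedNbhd hab hac hbc hN, hN, Finset.prod_insert (by simp [hab, hac]),
      Finset.prod_pair hbc]
  simp only [hF]
  rw [avg_three_edges hva hvb hvc hab hac hbc (fun r s t : ℝ =>
    ((r * s * t : ℝ) : ℂ) * ph (-(γ / 2)) (r * s * t) *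
        (branchPhase γ r * (branchPhase γ s * branchPhase γ t)))]
  simp only [branchPhase_eq γ (Or.inl rfl), branchPhase_eq γ (Or.inr rfl)]
  simp only [mul_one, mul_neg, neg_neg, ph_one, ph_neg_one, Real.cos_neg, Real.sin_neg]
  generalize Real.cos (γ / 2) * Real.cos γ ^ 3 - Real.sin (γ / 2) * Real.sin γ ^ 3 = p
  generalize Real.sin γ * Real.cos γ * Real.cos (γ / 2) = q
  push_cast
  ring_nf
  simp only [I_pow_three]
  ring

theorem mem_biUnion_neighborFinset_erase {v q : V} :
    q ∈ ((G.neighborFinset v).biUnion fun p => (G.neighborFinset p).erase v) ↔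
      ∃ p, G.Adj v p ∧ G.Adj p q ∧ q ≠ v := by
  simp only [Finset.mem_biUnion, Finset.mem_erase, G.mem_neighborFinset]
  exact exists_congr fun p => by tauto

theorem notMem_closedNbhd_of_mem_biUnion (hg : 7 ≤ G.egirth) {v q : V}
    (hq : q ∈ ((G.neighborFinset v).biUnion fun p => (G.neighborFinset p).erase v)) :
    q ∉ closedNbhd G v := by
  obtain ⟨p, hp, hpq, hqv⟩ := mem_biUnion_neighborFinset_erase.mp hq
  exact notMem_closedNbhd_of_mem_erase hg hp
    (Finset.mem_erase.mpr ⟨hqv, (G.mem_neighborFinset p q).mpr hpq⟩)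

theorem card_biUnion_neighborFinset_erase (hreg : G.IsRegularOfDegree 3) (hg : 7 ≤ G.egirth)
    (v : V) : ((G.neighborFinset v).biUnion fun p => (G.neighborFinset p).erase v).card = 6 := by
  have hadj : ∀ p, p ∈ G.neighborFinset v → G.Adj v p := fun p => (G.mem_neighborFinset v p).mp
  have h3 : (G.neighborFinset v).card = 3 := hreg v
  rw [Finset.card_biUnion fun p hp p' hp' hne =>
      disjoint_neighborFinset_erase hg (hadj p hp) (hadj p' hp') hne,
    Finset.sum_congr rfl fun p hp => card_neighborFinset_erase hreg (hadj p hp),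
    Finset.sum_const, h3]
  rfl

/-- Every second-level vertex `w` has a neighbour that no other star of the product in
`exp_energy_diff_neighborFinset` contains. -/
theorem exists_neighbor_notMem_closedNbhd (hreg : G.IsRegularOfDegree 3) (hg : 7 ≤ G.egirth)
    {v w : V}
    (hw : w ∈ ((G.neighborFinset v).biUnion fun p => (G.neighborFinset p).erase v)) :
    ∃ r, r ∈ closedNbhd G w ∧ r ∉ closedNbhd G v ∧
      (∀ p ∈ G.neighborFinset v, r ∉ closedNbhd G p) ∧
      ∀ w' ∈ ((G.neighborFinset v).biUnion fun p => (G.neighborFinset p).erase v),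
        w' ≠ w → r ∉ closedNbhd G w' := by
  obtain ⟨p, hp, hpq, hqv⟩ := mem_biUnion_neighborFinset_erase.mp hw
  obtain ⟨r, hr, hrp⟩ := exists_adj_ne hreg w p
  obtain ⟨h1, h2, h3⟩ := not_adj_of_third_step hg hp hpq hqv hr hrp
  refine ⟨r, mem_closedNbhd.mpr (Or.inr hr), ?_, ?_, ?_⟩
  · rw [mem_closedNbhd]
    rintro (rfl | h)
    · exact h2 p hp hp.symm
    · exact h1 h
  · intro p' hp' h
    rw [G.mem_neighborFinset] at hp'
    rcases mem_closedNbhd.mp h with rfl | h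
    · exact h1 hp'
    · exact h2 _ hp' h
  · intro w' hw' hne h
    obtain ⟨p', hp', hpq', hqv'⟩ := mem_biUnion_neighborFinset_erase.mp hw'
    rcases mem_closedNbhd.mp h with rfl | h
    · exact h2 p' hp' hpq'
    · exact h3 p' w' hp' hpq' hqv' hne h

theorem exp_energy_diff_neighborFinset (hreg : G.IsRegularOfDegree 3) (hg : 7 ≤ G.egirth)
    (γ : ℝ) (v : V) (z : V → Fin 2) :
    Complex.exp (Complex.I *
        (γ * (energy G (z + ind (G.neighborFinset v)) - energy G z) : ℝ)) =
      ph (-(γ / 2)) (chi (closedNbhd G v) z) *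
        (∏ p ∈ G.neighborFinset v, ((∏ u ∈ G.neighborFinset p, ph γ (chi {p, u} z)) *
          ph (-(γ / 2)) (chi (closedNbhd G p) z))) *
        ∏ q ∈ (G.neighborFinset v).biUnion fun p => (G.neighborFinset p).erase v,
          ph (-(γ / 2)) (chi (closedNbhd G q) z) := by
  obtain ⟨a, b, c, hab, hac, hbc, hN⟩ := exists_neighbors hreg v
  have hQ := fun q => notMem_closedNbhd_of_mem_biUnion (q := q) hg (v := v)
  have hPQ : Disjoint (G.neighborFinset v)
      ((G.neighborFinset v).biUnion fun p => (G.neighborFinset p).erase v) := by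
    rw [Finset.disjoint_left]
    intro p hp hpQ
    exact hQ p hpQ (Finset.mem_insert_of_mem hp)
  have hvPQ : v ∉ G.neighborFinset v ∪
      ((G.neighborFinset v).biUnion fun p => (G.neighborFinset p).erase v) := by
    rw [Finset.mem_union, G.mem_neighborFinset]
    rintro (h | h)
    · exact h.ne rfl
    · exact hQ v h (Finset.mem_insert_self _ _)
  rw [exp_energy_diff, oddCenters_neighborFinset hg hab hac hbc hN, Finset.prod_insert hvPQ,
    Finset.prod_union hPQ, ← prod_edges_mul_prod_closedNbhd hg γ v z]
  ring

theorem corr_star_leaves_eq_avg (hreg : G.IsRegularOfDegree 3) (hg : 7 ≤ G.egirth) (γ : ℝ)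
    (v : V) :
    corr (energy G) γ (closedNbhd G v) (G.neighborFinset v) = (Real.cos (γ / 2) : ℂ) ^ 6 *
      avg fun z => (chi (closedNbhd G v) z : ℂ) * ph (-(γ / 2)) (chi (closedNbhd G v) z) *
        ∏ p ∈ G.neighborFinset v, ((∏ u ∈ G.neighborFinset p, ph γ (chi {p, u} z)) *
          ph (-(γ / 2)) (chi (closedNbhd G p) z)) := by
  choose! ρ hρ1 hρ2 hρ3 hρ4 using fun w hw =>
    exists_neighbor_notMem_closedNbhd hreg hg (v := v) (w := w) hw
  have key := avg_prod_chi_pivot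
    ((G.neighborFinset v).biUnion fun p => (G.neighborFinset p).erase v) ρ
    (fun w => closedNbhd G w) (fun _ => ph (-(γ / 2))) (fun _ => (Real.cos (γ / 2) : ℂ))
    (fun z => (chi (closedNbhd G v) z : ℂ) * ph (-(γ / 2)) (chi (closedNbhd G v) z) *
        ∏ p ∈ G.neighborFinset v, ((∏ u ∈ G.neighborFinset p, ph γ (chi {p, u} z)) *
          ph (-(γ / 2)) (chi (closedNbhd G p) z))) ?_ hρ1 hρ4 ?_
  · rw [Finset.prod_const, card_biUnion_neighborFinset_erase hreg hg v] at key
    rw [← key, corr]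
    refine congrArg avg (funext fun z => ?_)
    rw [exp_energy_diff_neighborFinset hreg hg, ← mul_assoc, ← mul_assoc]
  · intro w hw z
    rw [chi_add_ind_singleton_of_notMem (hρ2 w hw)]
    exact congrArg _ (Finset.prod_congr rfl fun p hp =>
      prod_ph_mul_ph_add_ind (hρ3 w hw p hp) γ z)
  · intro w _
    rw [ph_add_ph_neg _ _ (Or.inl rfl), Real.cos_neg]

/-- The correlator of the star at `v` with `Y` on all three neighbours. -/
theorem corr_star_leaves (hreg : G.IsRegularOfDegree 3) (hg : 7 ≤ G.egirth) (γ : ℝ) (v : V) :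
    corr (energy G) γ (closedNbhd G v) (G.neighborFinset v) =
      -(Complex.I * (Real.cos (γ / 2) ^ 6 * (Real.sin (γ / 2) *
          (Real.cos (γ / 2) * Real.cos γ ^ 3 - Real.sin (γ / 2) * Real.sin γ ^ 3) ^ 3
        + Real.cos (γ / 2) * (Real.sin γ * Real.cos γ * Real.cos (γ / 2)) ^ 3) : ℝ)) := by
  have hPadj : ∀ p, p ∈ G.neighborFinset v ↔ G.Adj v p := fun p => G.mem_neighborFinset v p
  rw [corr_star_leaves_eq_avg hreg hg]
  -- the two outer neighbours `x p`, `y p` of each neighbour `p` of `v`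
  have hxy : ∀ p ∈ G.neighborFinset v, ∃ x y, v ≠ x ∧ v ≠ y ∧ x ≠ y ∧
      G.neighborFinset p = {v, x, y} :=
    fun p hp => exists_neighbors_of_adj hreg ((hPadj p).mp hp).symm
  choose! x y hvx hvy hxy hNp using hxy
  have hxQ : ∀ p ∈ G.neighborFinset v, x p ∈ (G.neighborFinset p).erase v := fun p hp => by
    rw [Finset.mem_erase, hNp p hp]; exact ⟨(hvx p hp).symm, by simp⟩
  have hyQ : ∀ p ∈ G.neighborFinset v, y p ∈ (G.neighborFinset p).erase v := fun p hp => by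
    rw [Finset.mem_erase, hNp p hp]; exact ⟨(hvy p hp).symm, by simp⟩
  have hxnot : ∀ p ∈ G.neighborFinset v, x p ∉ closedNbhd G v := fun p hp =>
    notMem_closedNbhd_of_mem_erase hg ((hPadj p).mp hp) (hxQ p hp)
  have hynot : ∀ p ∈ G.neighborFinset v, y p ∉ closedNbhd G v := fun p hp =>
    notMem_closedNbhd_of_mem_erase hg ((hPadj p).mp hp) (hyQ p hp)
  have hdisj : ∀ p ∈ G.neighborFinset v, ∀ p' ∈ G.neighborFinset v, p' ≠ p →
      ∀ q' ∈ (G.neighborFinset p').erase v,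
      ∀ q ∈ (G.neighborFinset p).erase v, q' ≠ q := fun p hp p' hp' hne q' hq' q hq h =>
    Finset.disjoint_left.mp (disjoint_neighborFinset_erase hg ((hPadj p').mp hp')
      ((hPadj p).mp hp) hne) hq' (h ▸ hq)
  have hKstar : ∀ z, ∏ p ∈ G.neighborFinset v,
      ((∏ u ∈ G.neighborFinset p, ph γ (chi {p, u} z)) *
        ph (-(γ / 2)) (chi (closedNbhd G p) z)) =
      ∏ p ∈ G.neighborFinset v, starPhase γ (spin (z p) * spin (z v)) (spin (z p) * spin (z (x p)))
        (spin (z p) * spin (z (y p))) := fun z =>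
    Finset.prod_congr rfl fun p hp =>
      prod_ph_mul_ph_eq_starPhase (hvx p hp) (hvy p hp) (hxy p hp) (hNp p hp) γ z
  simp only [hKstar]
  have hEinv : ∀ r, r ∉ closedNbhd G v → ∀ z : V → Fin 2,
      (chi (closedNbhd G v) (z + ind {r}) : ℂ) *
        ph (-(γ / 2)) (chi (closedNbhd G v) (z + ind {r})) =
      (chi (closedNbhd G v) z : ℂ) * ph (-(γ / 2)) (chi (closedNbhd G v) z) := fun r hr z => by
    rw [chi_add_ind_singleton_of_notMem hr]
  rw [avg_mul_prod_starPhase x y γ (fun z => (chi (closedNbhd G v) z : ℂ) *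
      ph (-(γ / 2)) (chi (closedNbhd G v) z)) (fun p hp => hEinv _ (hxnot p hp))
    (fun p hp => hEinv _ (hynot p hp)) hvx hvy
    (fun p hp p' hp' h => hxnot p hp (h ▸ Finset.mem_insert_of_mem hp'))
    (fun p hp p' hp' h => hynot p hp (h ▸ Finset.mem_insert_of_mem hp'))
    (fun p hp p' hp' hne => hdisj p hp p' hp' hne _ (hxQ p' hp') _ (hxQ p hp))
    (fun p hp p' hp' hne => hdisj p hp p' hp' hne _ (hyQ p' hp') _ (hyQ p hp))
    (fun p hp p' hp' => by
      by_cases hne : p' = p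
      · subst hne; exact (hxy p' hp').symm
      · exact hdisj p hp p' hp' hne _ (hyQ p' hp') _ (hxQ p hp))]
  rw [avg_star_mul_prod_branchPhase hreg γ v]
  push_cast
  ring

/-! ### The expectation in closed form -/

omit [Fintype V] in
theorem sum_powerset_singleton (c : V) (f : Finset V → ℂ) :
    ∑ B ∈ ({c} : Finset V).powerset, f B = f ∅ + f {c} := by
  have := Finset.sum_powerset_insert (Finset.notMem_empty c) f
  simpa using this

omit [Fintype V] in
theorem sum_powerset_pair {b c : V} (hbc : b ≠ c) (f : Finset V → ℂ) :
    ∑ B ∈ ({b, c} : Finset V).powerset, f B = f ∅ + f {c} + (f {b} + f {b, c}) := by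
  rw [Finset.sum_powerset_insert (by simpa using hbc), sum_powerset_singleton,
    sum_powerset_singleton, insert_empty_eq]

theorem expectation_edge (hreg : G.IsRegularOfDegree 3) (hg : 7 ≤ G.egirth) (γ β : ℝ) {v u : V}
    (h : G.Adj v u) :
    ∑ B ∈ ({v, u} : Finset V).powerset,
      (Real.cos (2 * β) : ℂ) ^ (({v, u} : Finset V) \ B).card *
        (Complex.I * (Real.sin (2 * β) : ℂ)) ^ B.card * corr (energy G) γ {v, u} B =
      ((-2 * Real.cos (2 * β) * Real.sin (2 * β) * Real.sin γ * Real.cos γ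
        * Real.cos (γ / 2) ^ 4 : ℝ) : ℂ) := by
  have hsub : ({v, u} : Finset V) ⊆ closedNbhd G v := by
    intro x hx
    rw [mem_closedNbhd]
    rcases Finset.mem_insert.mp hx with rfl | hx
    · exact Or.inl rfl
    · rw [Finset.mem_singleton.mp hx]; exact Or.inr h
  have heven : ∀ B ⊆ ({v, u} : Finset V), Even B.card → corr (energy G) γ {v, u} B = 0 :=
    fun B hB hc => corr_eq_zero_of_even hreg hg γ (hB.trans hsub) hB hc
      (odd_card_pair_inter_twoSteps hg (Finset.mem_insert_self _ _) h)
  have hcv : (({v, u} : Finset V) \ {v}).card = 1 := by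
    rw [Finset.card_sdiff_of_subset (by simp), Finset.card_pair h.ne]; simp
  have hcu : (({v, u} : Finset V) \ {u}).card = 1 := by
    rw [Finset.card_sdiff_of_subset (by simp), Finset.card_pair h.ne]; simp
  have hu : corr (energy G) γ {v, u} {u} =
      Complex.I * (Real.cos (γ / 2) ^ 4 * Real.sin γ * Real.cos γ : ℝ) := by
    rw [Finset.pair_comm]; exact corr_edge hreg hg γ h.symm
  rw [sum_powerset_pair h.ne,
    heven ∅ (Finset.empty_subset _) (by simp),
    heven {v, u} subset_rfl (by rw [Finset.card_pair h.ne]; decide), hcv, hcu, hu,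
    corr_edge hreg hg γ h, Finset.card_singleton, Finset.card_singleton]
  push_cast
  ring_nf
  simp only [Complex.I_sq]
  ring

theorem expectation_star (hreg : G.IsRegularOfDegree 3) (hg : 7 ≤ G.egirth) (γ β : ℝ) (v : V) :
    ∑ B ∈ (closedNbhd G v).powerset,
      (Real.cos (2 * β) : ℂ) ^ (closedNbhd G v \ B).card *
        (Complex.I * (Real.sin (2 * β) : ℂ)) ^ B.card * corr (energy G) γ (closedNbhd G v) B =
      ((Real.cos (2 * β) ^ 3 * Real.sin (2 * β) * (Real.cos (γ / 2) ^ 3 *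
            (Real.cos (γ / 2) * Real.sin γ ^ 3 + Real.sin (γ / 2) * Real.cos γ ^ 3)
          + 3 * (Real.cos (γ / 2) ^ 2 * Real.sin (γ / 2) *
            (Real.cos (γ / 2) * Real.cos γ ^ 3 - Real.sin (γ / 2) * Real.sin γ ^ 3)))
        - Real.cos (2 * β) * Real.sin (2 * β) ^ 3 * (Real.cos (γ / 2) ^ 6 * (Real.sin (γ / 2) *
            (Real.cos (γ / 2) * Real.cos γ ^ 3 - Real.sin (γ / 2) * Real.sin γ ^ 3) ^ 3
            + Real.cos (γ / 2) * (Real.sin γ * Real.cos γ * Real.cos (γ / 2)) ^ 3)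
          + 3 * (Real.sin (γ / 2) * Real.cos γ ^ 5 * Real.cos (γ / 2) ^ 5)) : ℝ) : ℂ) := by
  obtain ⟨a, b, c, hab, hac, hbc, hN⟩ := exists_neighbors hreg v
  obtain ⟨hva, hvb, hvc⟩ := ne_of_neighborFinset_eq hN
  obtain ⟨hda, hdb, hdc⟩ := adj_of_neighborFinset_eq hN
  have hNcb : G.neighborFinset v = {a, c, b} := by rw [hN, Finset.pair_comm b]
  have hNbc : G.neighborFinset v = {b, c, a} := by
    rw [hN, Finset.insert_comm a b, Finset.pair_comm a]
  have heven : ∀ B ⊆ closedNbhd G v, Even B.card → corr (energy G) γ (closedNbhd G v) B = 0 :=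
    fun B hB hc => corr_eq_zero_of_even hreg hg γ hB hB hc
      (odd_card_closedNbhd_inter_of_mem hg (self_mem_twoSteps hda))
  have hcard : (closedNbhd G v).card = 4 := by
    rw [closedNbhd, Finset.card_insert_of_notMem (by simp), G.card_neighborFinset_eq_degree, hreg v]
  have hsum : ∑ B ∈ (closedNbhd G v).powerset,
      (Real.cos (2 * β) : ℂ) ^ (closedNbhd G v \ B).card *
        (Complex.I * (Real.sin (2 * β) : ℂ)) ^ B.card * corr (energy G) γ (closedNbhd G v) B =
      ∑ B ∈ (closedNbhd G v).powerset, if Odd B.card then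
        (Real.cos (2 * β) : ℂ) ^ (4 - B.card) *
        (Complex.I * (Real.sin (2 * β) : ℂ)) ^ B.card * corr (energy G) γ (closedNbhd G v) B
        else 0 := by
    refine Finset.sum_congr rfl fun B hB => ?_
    rw [Finset.mem_powerset] at hB
    split_ifs with h
    · rw [Finset.card_sdiff_of_subset hB, hcard]
    · rw [heven B hB (Nat.not_odd_iff_even.mp h), mul_zero]
  have h3 := corr_star_leaves hreg hg γ v
  have h1 := corr_star_center hreg hg γ v
  have ha := corr_star_leaf hreg hg γ hda
  have hb := corr_star_leaf hreg hg γ hdb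
  have hc := corr_star_leaf hreg hg γ hdc
  have hvab := corr_star_center_and_two hreg hg γ hab hac hbc hN
  have hvac := corr_star_center_and_two hreg hg γ hac hab hbc.symm hNcb
  have hvbc := corr_star_center_and_two hreg hg γ hbc hab.symm hac.symm hNbc
  rw [hsum]
  set S := closedNbhd G v with hS
  have hS' : S = {v, a, b, c} := by rw [hS, closedNbhd, hN]
  rw [hN] at h3
  have exp4 : ∀ f : Finset V → ℂ, ∑ B ∈ S.powerset, f B =
      f ∅ + f {c} + (f {b} + f {b, c}) + (f {a} + f {a, c} + (f {a, b} + f {a, b, c})) +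
      (f {v} + f {v, c} + (f {v, b} + f {v, b, c}) +
        (f {v, a} + f {v, a, c} + (f {v, a, b} + f {v, a, b, c}))) := by
    intro f
    have ha : a ∉ ({b, c} : Finset V) := by simp [hab, hac]
    rw [hS', Finset.sum_powerset_insert (by simp [hva, hvb, hvc]),
      Finset.sum_powerset_insert ha, Finset.sum_powerset_insert ha]
    simp only [sum_powerset_pair hbc, insert_empty_eq]
  rw [exp4]
  have c3 : ∀ {x y t : V}, x ≠ y → x ≠ t → y ≠ t → ({x, y, t} : Finset V).card = 3 :=
    fun h1 h2 h3 => Finset.card_eq_three.mpr ⟨_, _, _, h1, h2, h3, rfl⟩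
  have c4 : ({v, a, b, c} : Finset V).card = 4 := by rw [← hS', hcard]
  rw [c3 hab hac hbc, c3 hva hvb hab, c3 hva hvc hac, c3 hvb hvc hbc, c4,
    Finset.card_pair hbc, Finset.card_pair hac, Finset.card_pair hab, Finset.card_pair hva,
    Finset.card_pair hvb, Finset.card_pair hvc, h1, ha, hb, hc, h3, hvab, hvac, hvbc]
  simp only [Finset.card_singleton, Finset.card_empty, show ¬ Odd 0 by decide,
    show ¬ Odd 2 by decide, show ¬ Odd 4 by decide, show Odd 1 by decide, show Odd 3 by decide,
    if_true, if_false]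
  push_cast
  ring_nf
  simp only [Complex.I_sq, Complex.I_pow_four]
  ring

theorem cos_five_mul (x : ℝ) :
    Real.cos (5 * x) = 16 * Real.cos x ^ 5 - 20 * Real.cos x ^ 3 + 5 * Real.cos x := by
  rw [show 5 * x = 2 * x + 3 * x by ring, Real.cos_add, Real.cos_two_mul, Real.cos_three_mul,
    Real.sin_two_mul, Real.sin_three_mul]
  have h := Real.sin_sq_add_cos_sq x
  linear_combination (8 * Real.cos x * (Real.sin x ^ 2 - Real.cos x ^ 2 + 1) - 6 * Real.cos x) * h

theorem sin_five_mul (x : ℝ) :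
    Real.sin (5 * x) = 16 * Real.sin x ^ 5 - 20 * Real.sin x ^ 3 + 5 * Real.sin x := by
  have := cos_five_mul (Real.pi / 2 - x)
  rw [Real.cos_pi_div_two_sub] at this
  rw [← this, show 5 * (Real.pi / 2 - x) = Real.pi / 2 - 5 * x + 2 * Real.pi by ring,
    Real.cos_add_two_pi, Real.cos_pi_div_two_sub]

theorem three_mul_cos_add_cos (γ : ℝ) : 3 * Real.cos (3 * γ / 2) + Real.cos (5 * γ / 2) =
    4 * (Real.cos (γ / 2) * Real.cos γ ^ 3 - Real.sin (γ / 2) * Real.sin γ ^ 3) := by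
  obtain ⟨x, rfl⟩ : ∃ x, γ = 2 * x := ⟨γ / 2, by ring⟩
  rw [show 3 * (2 * x) / 2 = 3 * x by ring, show 5 * (2 * x) / 2 = 5 * x by ring,
    show 2 * x / 2 = x by ring, Real.cos_three_mul, cos_five_mul, Real.cos_two_mul,
    Real.sin_two_mul]
  have h := Real.sin_sq_add_cos_sq x
  linear_combination 32 * Real.cos x ^ 3 * (Real.sin x ^ 2 + 1 - Real.cos x ^ 2) * h

theorem three_mul_sin_sub_sin (γ : ℝ) : 3 * Real.sin (3 * γ / 2) - Real.sin (5 * γ / 2) =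
    4 * (Real.cos (γ / 2) * Real.sin γ ^ 3 + Real.sin (γ / 2) * Real.cos γ ^ 3) := by
  obtain ⟨x, rfl⟩ : ∃ x, γ = 2 * x := ⟨γ / 2, by ring⟩
  rw [show 3 * (2 * x) / 2 = 3 * x by ring, show 5 * (2 * x) / 2 = 5 * x by ring,
    show 2 * x / 2 = x by ring, Real.sin_three_mul, sin_five_mul, Real.cos_two_mul,
    Real.sin_two_mul]
  have h : Real.cos x ^ 2 = 1 - Real.sin x ^ 2 := by linarith [Real.sin_sq_add_cos_sq x]
  rw [h, show (2 * Real.sin x * Real.cos x) ^ 3 =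
    8 * Real.sin x ^ 3 * Real.cos x ^ 2 * Real.cos x by ring, h]
  have h4 : Real.cos x * (8 * Real.sin x ^ 3 * (1 - Real.sin x ^ 2) * Real.cos x) =
    8 * Real.sin x ^ 3 * (1 - Real.sin x ^ 2) * Real.cos x ^ 2 := by ring
  rw [h4, h]
  ring

/-- The expectation divided by the number of vertices, with the multiple angles `3γ/2` and `5γ/2`
of the closed formula folded into powers. -/
def expectationPerVertex (γ β : ℝ) : ℝ :=
  1 / 2
    + 3 / 2 * Real.cos (2 * β) * Real.sin (2 * β) * Real.sin γ * Real.cos γ * Real.cos (γ / 2) ^ 4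
    + 1 / 4 * Real.sin (2 * β) * Real.cos (2 * β) ^ 3 * Real.cos (γ / 2) ^ 3
        * (Real.cos (γ / 2) * Real.sin γ ^ 3 + Real.sin (γ / 2) * Real.cos γ ^ 3)
    + 3 / 4 * Real.sin (2 * β) * Real.cos (2 * β) ^ 3 * Real.sin (γ / 2) * Real.cos (γ / 2) ^ 2
        * (Real.cos (γ / 2) * Real.cos γ ^ 3 - Real.sin (γ / 2) * Real.sin γ ^ 3)
    - 3 / 4 * Real.sin (2 * β) ^ 3 * Real.cos (2 * β) * Real.sin (γ / 2) * Real.cos γ ^ 5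
        * Real.cos (γ / 2) ^ 5
    - 1 / 4 * Real.sin (2 * β) ^ 3 * Real.cos (2 * β) * Real.cos (γ / 2) ^ 6
        * (Real.sin (γ / 2)
            * (Real.cos (γ / 2) * Real.cos γ ^ 3 - Real.sin (γ / 2) * Real.sin γ ^ 3) ^ 3
          + Real.sin γ ^ 3 * Real.cos γ ^ 3 * Real.cos (γ / 2) ^ 4)

theorem qaoaExpectation_eq (hreg : G.IsRegularOfDegree 3) (hg : 7 ≤ G.egirth) (γ β : ℝ) :
    qaoaExpectation (hamiltonian G) γ β =
      ((Fintype.card V * expectationPerVertex γ β : ℝ) : ℂ) := by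
  rw [qaoaExpectation_hamiltonian]
  have hv : ∀ v : V, (1 / 2 - 1 / 4 * (∑ u ∈ G.neighborFinset v,
          ∑ B ∈ ({v, u} : Finset V).powerset,
            (Real.cos (2 * β) : ℂ) ^ (({v, u} : Finset V) \ B).card *
            (Complex.I * (Real.sin (2 * β) : ℂ)) ^ B.card * corr (energy G) γ {v, u} B)
        + 1 / 4 * ∑ B ∈ (insert v (G.neighborFinset v)).powerset,
            (Real.cos (2 * β) : ℂ) ^ (insert v (G.neighborFinset v) \ B).card *
            (Complex.I * (Real.sin (2 * β) : ℂ)) ^ B.card *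
              corr (energy G) γ (insert v (G.neighborFinset v)) B) =
      (expectationPerVertex γ β : ℂ) := by
    intro v
    have h3 : (G.neighborFinset v).card = 3 := hreg v
    rw [expectation_star hreg hg γ β v, Finset.sum_congr rfl fun u hu =>
      expectation_edge hreg hg γ β ((G.mem_neighborFinset v u).mp hu), Finset.sum_const, h3,
      expectationPerVertex]
    push_cast
    ring
  rw [Finset.sum_congr rfl fun v _ => hv v, Finset.sum_const, Finset.card_univ]
  push_cast
  rw [nsmul_eq_mul]

/-- The maximum of the formula is about `0.8193`. The Pythagorean triples `(176, 57, 185)` for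
`γ / 2` and `(105, 88, 137)` for `2β` give a nearby point where all values are rational. -/
theorem exists_expectationPerVertex_mem :
    ∃ γ ∈ Set.Ico (0 : ℝ) (2 * Real.pi), ∃ β ∈ Set.Ico (0 : ℝ) Real.pi,
      0.819 ≤ expectationPerVertex γ β ∧ expectationPerVertex γ β ≤ 0.8195 := by
  have hpi := Real.pi_pos
  have hx : Real.arccos (176 / 185) < Real.pi := by
    refine lt_of_le_of_ne (Real.arccos_le_pi _) fun h => ?_
    rw [Real.arccos_eq_pi] at h; norm_num at h
  refine ⟨2 * Real.arccos (176 / 185), ⟨by linarith [Real.arccos_nonneg (176 / 185)], by linarith⟩,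
    Real.arccos (105 / 137) / 2, ⟨by linarith [Real.arccos_nonneg (105 / 137)], by
      linarith [Real.arccos_le_pi (105 / 137)]⟩, ?_⟩
  have c1 : Real.cos (Real.arccos (176 / 185)) = 176 / 185 :=
    Real.cos_arccos (by norm_num) (by norm_num)
  have s1 : Real.sin (Real.arccos (176 / 185)) = 57 / 185 := by
    rw [Real.sin_arccos, show (1 - (176 / 185) ^ 2 : ℝ) = (57 / 185) ^ 2 by norm_num,
      Real.sqrt_sq (by norm_num)]
  have c2 : Real.cos (Real.arccos (105 / 137)) = 105 / 137 :=
    Real.cos_arccos (by norm_num) (by norm_num)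
  have s2 : Real.sin (Real.arccos (105 / 137)) = 88 / 137 := by
    rw [Real.sin_arccos, show (1 - (105 / 137) ^ 2 : ℝ) = (88 / 137) ^ 2 by norm_num,
      Real.sqrt_sq (by norm_num)]
  rw [expectationPerVertex, mul_div_cancel_left₀ _ (two_ne_zero' ℝ),
    mul_div_cancel₀ _ (two_ne_zero' ℝ), Real.cos_two_mul, Real.sin_two_mul, c1, s1, c2, s2]
  constructor <;> norm_num

end Flips

end LocalMaxCutQAOA

end

theorem theorem6 {V : Type*} [Fintype V] [DecidableEq V] (G : SimpleGraph V)
    [DecidableRel G.Adj] (hreg : G.IsRegularOfDegree 3) (hgirth : 7 ≤ G.egirth) :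
    (∀ γ β : ℝ,
      LocalMaxCutQAOA.qaoaExpectation (LocalMaxCutQAOA.hamiltonian G) γ β =
        (((Fintype.card V : ℝ) *
          (1 / 2
            + 3 / 2 * Real.cos (2 * β) * Real.sin (2 * β) * Real.sin γ * Real.cos γ
                * Real.cos (γ / 2) ^ 4
            + 1 / 16 * Real.sin (2 * β) * Real.cos (2 * β) ^ 3 * Real.cos (γ / 2) ^ 3
                * (3 * Real.sin (3 * γ / 2) - Real.sin (5 * γ / 2))
            + 3 / 16 * Real.sin (2 * β) * Real.cos (2 * β) ^ 3 * Real.sin (γ / 2)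
                * Real.cos (γ / 2) ^ 2
                * (3 * Real.cos (3 * γ / 2) + Real.cos (5 * γ / 2))
            - 3 / 4 * Real.sin (2 * β) ^ 3 * Real.cos (2 * β) * Real.sin (γ / 2)
                * Real.cos γ ^ 5 * Real.cos (γ / 2) ^ 5
            - 1 / 4 * Real.sin (2 * β) ^ 3 * Real.cos (2 * β) * Real.cos (γ / 2) ^ 6
                * (1 / 64 * Real.sin (γ / 2)
                      * (3 * Real.cos (3 * γ / 2) + Real.cos (5 * γ / 2)) ^ 3
                    + Real.sin γ ^ 3 * Real.cos γ ^ 3 * Real.cos (γ / 2) ^ 4)) : ℝ) : ℂ)) ∧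
    ∃ γ ∈ Set.Ico (0 : ℝ) (2 * Real.pi), ∃ β ∈ Set.Ico (0 : ℝ) Real.pi,
      0.819 * (Fintype.card V : ℝ)
          ≤ (LocalMaxCutQAOA.qaoaExpectation (LocalMaxCutQAOA.hamiltonian G) γ β).re ∧
      (LocalMaxCutQAOA.qaoaExpectation (LocalMaxCutQAOA.hamiltonian G) γ β).re
          ≤ 0.8195 * (Fintype.card V : ℝ) := by
  have formula := fun γ β => LocalMaxCutQAOA.qaoaExpectation_eq (G := G) hreg hgirth γ β
  refine ⟨fun γ β => ?_, ?_⟩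
  · rw [formula, LocalMaxCutQAOA.expectationPerVertex, LocalMaxCutQAOA.three_mul_cos_add_cos,
      LocalMaxCutQAOA.three_mul_sin_sub_sin]
    congr 2
    ring
  · obtain ⟨γ, hγ, β, hβ, hlow, hhigh⟩ := LocalMaxCutQAOA.exists_expectationPerVertex_mem
    have hn : (0 : ℝ) ≤ Fintype.card V := Nat.cast_nonneg _
    refine ⟨γ, hγ, β, hβ, ?_, ?_⟩
    · rw [formula, Complex.ofReal_re, mul_comm]
      exact mul_le_mul_of_nonneg_left hlow hn
    · rw [formula, Complex.ofReal_re, mul_comm _ (Fintype.card V : ℝ)]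
      exact mul_le_mul_of_nonneg_left hhigh hn
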